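/- Let $\Sigma$ be an alphabet and $\bar\Sigma=\Sigma\cup\{\varepsilon\}$. A \emph{forest} is a balanced string of parentheses labelled by elements of $\Sigma$, i.e. an element of the smallest set of strings that contains the empty string and is closed under concatenation and under $F\mapsto (_a\,F\,)_a$ for $a\in\Sigma$; a \emph{tree} is a forest of the form $(_a\,F\,)_a$ with $F$ a forest. A \emph{node} $u=(o(u),c(u))$ of a forest $F$ is a pair of positions such that $F[o(u)..c(u)]$ is a tree. A \emph{context} $C=\langle C_L;C_R\rangle$ is a pair of non-empty strings (its \emph{halves}) such that $C_L\cdot C_R$ is a tree; its length is $|C|=|C_L|+|C_R|$. Contexts are composed by $C\star D=\langle C_LD_L;D_RC_R\rangle$, and $Q^m$ is the composition of $m$ copies of $Q$. The context $C$ \emph{occurs} in $F$ at a node $u$ if $F[o(u)..c(u)]=C_L\cdot H\cdot C_R$ for some forest $H$; replacing this occurrence by a context $C'$ means replacing $C_L\cdot H\cdot C_R$ by $C'_L\cdot H\cdot C'_R$ there. A \emph{normalized quasimetric} is a function $w:\bar\Sigma\times\bar\Sigma\to[0,\infty]$ with $w(a,a)=0$, $w(a,c)\le w(a,b)+w(b,c)$,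 and $w(a,b)\ge 1$ whenever $a\ne b$. An \emph{alignment} of a string $X$ onto a string $Y$ is a sequence of pairs from $(0,0)$ to $(|X|,|Y|)$ in which each pair $(x,y)$ is followed by $(x+1,y+1)$ ($X[x]$ is aligned to $Y[y]$), $(x+1,y)$ ($X[x]$ is deleted), or $(x,y+1)$ ($Y[y]$ is inserted). It is a \emph{forest alignment} of a forest $F$ onto a forest $G$ if for every node $u$ of $F$ either both $F[o(u)]$ and $F[c(u)]$ are deleted, or for some node $v$ of $G$ both $F[o(u)]$ is aligned to $G[o(v)]$ and $F[c(u)]$ is aligned to $G[c(v)]$. Its cost is one half of the sum, over its steps, of $w(a,b)$ for aligning a parenthesis labelled $a$ to one labelled $b$, $w(a,\varepsilon)$ for deleting a parenthesis labelled $a$, and $w(\varepsilon,b)$ for inserting one labelled $b$. Let $\mathsf{ted}^w(F,G)$ be the minimum cost of a forest alignment of $F$ onto $G$, and let $\mathsf{ted}^w_{\le k}(F,G)$ be $\mathsf{ted}^w(F,G)$ if this is at most $k$ and $\infty$ otherwise. Contexts $P,P'$ are \emph{$\mathsf{ted}^w_{\le k}$-equivalent} if $\mathsf{ted}^w_{\le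 k}(F,G)=\mathsf{ted}^w_{\le k}(F',G')$ for all forests $F,G$ in which $P$ occurs at nodes $u$ and $v$, respectively, with $|o(u)-o(v)|\le 2k$ and $|c(u)-c(v)|\le 2k$, where $F',G'$ arise from $F,G$ by replacing these occurrences of $P$ by $P'$. A context $P$ \emph{avoids vertical $k$-periodicity} if it cannot be written as $P=C\star Q^{6k+1}\star D$ with contexts $C,Q,D$ such that $1\le|Q|\le 8k$. \textbf{Lemma.} Let $k\ge 1$ be an integer and let $P,P'$ be contexts with $|P|,|P'|\ge 578k^4$ that avoid vertical $k$-periodicity and whose halves contain no balanced substring (i.e. no substring that is a forest) of length more than $74k^3$. Then $P$ and $P'$ are $\mathsf{ted}^w_{\le k}$-equivalent for every normalized quasimetric $w$. -/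

import Mathlib

open scoped ENNReal NNReal

namespace TreeEdit

/-- Parentheses labelled over the alphabet `α`. -/
inductive Paren (α : Type*) where
  | opening (a : α) : Paren α
  | closing (a : α) : Paren α

/-- The label of a parenthesis. -/
def Paren.label {α : Type*} : Paren α → α
  | .opening a => a
  | .closing a => a

/-- Forests with node labels over `α`: the balanced strings of labelled parentheses. -/
inductive IsForest {α : Type*} : List (Paren α) → Prop where
  | nil : IsForest []
  | append {F G : List (Paren α)} : IsForest F → IsForest G → IsForest (F ++ G)
  | wrap (a : α) {F : List (Paren α)} :
      IsForest F → IsForest (Paren.opening a :: (F ++ [Paren.closing a]))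

/-- A tree: a forest enclosed by one matching pair of parentheses. -/
def IsTree {α : Type*} (T : List (Paren α)) : Prop :=
  ∃ (a : α) (F : List (Paren α)), IsForest F ∧
    T = Paren.opening a :: (F ++ [Paren.closing a])

/-- The fragment `X[i..j)` (positions `i, …, j - 1`). -/
def fragment {β : Type*} (X : List β) (i j : ℕ) : List β := (X.take j).drop i

/-- The nodes of `F`: the pairs `u = (o(u), c(u))` of positions of matching parentheses. -/
def nodes {α : Type*} (F : List (Paren α)) : Set (ℕ × ℕ) :=
  {u | u.1 < u.2 ∧ u.2 < F.length ∧ IsTree (fragment F u.1 (u.2 + 1))}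

/-! ### Contexts -/

/-- A context `⟨C_L; C_R⟩`: the two parts into which a hole, located strictly inside the root's
pair of parentheses, divides a tree. -/
@[ext]
structure Context (α : Type*) where
  left : List (Paren α)
  right : List (Paren α)
  left_ne_nil : left ≠ []
  right_ne_nil : right ≠ []
  isTree : IsTree (left ++ right)

theorem IsTree.isForest {α : Type*} {T : List (Paren α)} (h : IsTree T) : IsForest T := by
  obtain ⟨a, F, hF, rfl⟩ := h
  exact IsForest.wrap a hF

theorem IsForest.insert_aux {α : Type*} {Z : List (Paren α)} (hZ : IsForest Z)
    {W : List (Paren α)} (hW : IsForest W) :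
    ∀ X Y : List (Paren α), W = X ++ Y → IsForest (X ++ (Z ++ Y)) := by
  induction hW with
  | nil =>
    intro X Y h
    obtain ⟨rfl, rfl⟩ := List.append_eq_nil_iff.mp h.symm
    simpa using hZ
  | @append F G hF hG ihF ihG =>
    intro X Y h
    rcases List.append_eq_append_iff.mp h with ⟨A, rfl, rfl⟩ | ⟨A, rfl, rfl⟩
    · have := IsForest.append hF (ihG A Y rfl)
      simpa [List.append_assoc] using this
    · have := IsForest.append (ihF X A rfl) hG
      simpa [List.append_assoc] using this
  | @wrap a F hF ih =>
    intro X Y h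
    cases X with
    | nil =>
      simp only [List.nil_append] at h ⊢
      subst h
      exact IsForest.append hZ (IsForest.wrap a hF)
    | cons x X =>
      simp only [List.cons_append, List.cons.injEq] at h
      obtain ⟨rfl, h⟩ := h
      rcases List.eq_nil_or_concat Y with rfl | ⟨Y', y, rfl⟩
      · simp only [List.append_nil] at h
        subst h
        have := IsForest.append (IsForest.wrap a hF) hZ
        simpa [List.append_assoc] using this
      · simp only [List.concat_eq_append] at h ⊢
        rw [← List.append_assoc] at h
        obtain ⟨h1, h2⟩ := List.append_inj' h rfl
        simp only [List.cons.injEq, and_true] at h2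
        subst h2
        have := IsForest.wrap a (ih X Y' h1)
        simpa [List.append_assoc] using this

/-- Placing a forest in the hole of a context gives a tree. -/
theorem Context.isTree_fill {α : Type*} (C : Context α) {Z : List (Paren α)} (hZ : IsForest Z) :
    IsTree (C.left ++ (Z ++ C.right)) := by
  obtain ⟨L, R, hL, hR, a, F, hF, h⟩ := C
  cases L with
  | nil => exact absurd rfl hL
  | cons x L =>
    rcases List.eq_nil_or_concat R with rfl | ⟨R, y, rfl⟩
    · exact absurd rfl hR
    · simp only [List.concat_eq_append, List.cons_append, List.cons.injEq] at h ⊢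
      obtain ⟨rfl, h⟩ := h
      rw [← List.append_assoc] at h
      obtain ⟨h1, h2⟩ := List.append_inj' h rfl
      simp only [List.cons.injEq, and_true] at h2
      subst h2
      exact ⟨a, L ++ (Z ++ R), IsForest.insert_aux hZ hF L R h1.symm, by simp⟩

namespace Context

variable {α : Type*}

/-- The length `|C_L| + |C_R|` of a context. -/
def size (C : Context α) : ℕ := C.left.length + C.right.length

/-- Vertical composition `C ⋆ D = ⟨C_L · D_L; D_R · C_R⟩`. -/
def comp (C D : Context α) : Context α where
  left := C.left ++ D.left
  right := D.right ++ C.right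
  left_ne_nil := by simp [C.left_ne_nil]
  right_ne_nil := by simp [C.right_ne_nil]
  isTree := by simpa [List.append_assoc] using C.isTree_fill D.isTree.isForest

/-- The vertical power `Q^(n+1) = Q ⋆ ⋯ ⋆ Q`, with `n + 1` copies of `Q`. -/
def powSucc (Q : Context α) : ℕ → Context α
  | 0 => Q
  | n + 1 => Q.comp (powSucc Q n)

/-- `P` avoids vertical `k`-periodicity: it is not of the form `C ⋆ Q^(6k+1) ⋆ D` for contexts
`C, Q, D` with `1 ≤ |Q| ≤ 8k`. -/
def AvoidsVerticalPeriodicity (k : ℕ) (P : Context α) : Prop :=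
  ¬ ∃ C Q D : Context α, 1 ≤ Q.size ∧ Q.size ≤ 8 * k ∧ P = (C.comp (Q.powSucc (6 * k))).comp D

/-- No balanced substring of either half of `P` is longer than `ℓ`. -/
def HalvesBalancedAtMost (ℓ : ℕ) (P : Context α) : Prop :=
  ∀ B : List (Paren α), IsForest B → (B <:+: P.left ∨ B <:+: P.right) → B.length ≤ ℓ

/-- `C` occurs in `F` at the node `u`: `F[o(u)..c(u)] = C_L · H · C_R` for some forest `H`. -/
def OccursAt (C : Context α) (F : List (Paren α)) (u : ℕ × ℕ) : Prop :=
  u ∈ nodes F ∧ ∃ H : List (Paren α), IsForest H ∧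
    fragment F u.1 (u.2 + 1) = C.left ++ H ++ C.right

/-- `F` with the occurrence of `P` at the node `u` replaced by `P'`:
`F[0..o(u)) · P'_L · F[o(u)+|P_L| .. c(u)-|P_R|] · P'_R · F(c(u)..|F|)`. -/
def replace (P P' : Context α) (F : List (Paren α)) (u : ℕ × ℕ) : List (Paren α) :=
  F.take u.1 ++ P'.left ++ fragment F (u.1 + P.left.length) (u.2 + 1 - P.right.length) ++
    P'.right ++ F.drop (u.2 + 1)

end Context

/-! ### Alignments and their costs -/

/-- The steps that an alignment may take. -/
def AlignStep (p q : ℕ × ℕ) : Prop :=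
  q = (p.1 + 1, p.2 + 1) ∨ q = (p.1 + 1, p.2) ∨ q = (p.1, p.2 + 1)

/-- `A = (x_t, y_t)_{t=0}^m` is an alignment of a string of length `n` onto one of length `n'`. -/
structure IsAlignment (A : List (ℕ × ℕ)) (n n' : ℕ) : Prop where
  head : A.head? = some (0, 0)
  last : A.getLast? = some (n, n')
  chain : A.IsChain AlignStep

/-- `A` deletes the character at position `i` of the first string. -/
def Deletes (A : List (ℕ × ℕ)) (i : ℕ) : Prop := ∃ j, [(i, j), (i + 1, j)] <:+: A

/-- `A` aligns position `i` of the first string to position `j` of the second one. -/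
def Aligns (A : List (ℕ × ℕ)) (i j : ℕ) : Prop := [(i, j), (i + 1, j + 1)] <:+: A

/-- `A` is a forest alignment of `F` onto `G`. -/
structure IsForestAlignment {α : Type*} (A : List (ℕ × ℕ)) (F G : List (Paren α)) : Prop where
  isAlignment : IsAlignment A F.length G.length
  consistent : ∀ u ∈ nodes F, (Deletes A u.1 ∧ Deletes A u.2) ∨
    ∃ v ∈ nodes G, Aligns A u.1 v.1 ∧ Aligns A u.2 v.2

/-- Weights on `Σ ∪ {ε}`, where `none` is `ε`. -/
abbrev Weight (α : Type*) := Option α → Option α → ℝ≥0∞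

/-- A normalized quasimetric on `Σ ∪ {ε}`. -/
structure IsNormalizedQuasimetric {α : Type*} (w : Weight α) : Prop where
  self : ∀ a, w a a = 0
  triangle : ∀ a b c, w a c ≤ w a b + w b c
  normalized : ∀ a b, a ≠ b → 1 ≤ w a b

/-- The weight induced on parentheses: `w̃(p, q) = w(λ(p), λ(q))`. -/
def parenWeight {α : Type*} (w : Weight α) : Weight (Paren α) :=
  fun p q => w (p.map Paren.label) (q.map Paren.label)

/-- The cost of the step from `p` to `q`: the weight of the character of `X` consumed by the step
(`ε` if there is none) against the character of `Y` consumed by it (`ε` if there is none). -/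
noncomputable def stepCost {β : Type*} (w : Weight β) (X Y : List β) (p q : ℕ × ℕ) : ℝ≥0∞ :=
  w (if q.1 = p.1 + 1 then X[p.1]? else none) (if q.2 = p.2 + 1 then Y[p.2]? else none)

/-- The cost of an alignment `A` of the string `X` onto the string `Y`. -/
noncomputable def edCost {β : Type*} (w : Weight β) (X Y : List β) (A : List (ℕ × ℕ)) : ℝ≥0∞ :=
  ((A.zip A.tail).map fun s => stepCost w X Y s.1 s.2).sum

/-- The cost of a forest alignment `A` of `F` onto `G`. -/
noncomputable def tedCost {α : Type*} (w : Weight α) (F G : List (Paren α))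
    (A : List (ℕ × ℕ)) : ℝ≥0∞ :=
  edCost (parenWeight w) F G A / 2

/-- The weighted tree edit distance, the least cost of a forest alignment of `F` onto `G`
(there are finitely many of them, and at least one, so the infimum is a minimum). -/
noncomputable def ted {α : Type*} (w : Weight α) (F G : List (Paren α)) : ℝ≥0∞ :=
  ⨅ (A : List (ℕ × ℕ)) (_ : IsForestAlignment A F G), tedCost w F G A

open Classical in
/-- The weighted tree edit distance capped at the threshold `k`. -/
noncomputable def tedLe {α : Type*} (w : Weight α) (k : ℝ≥0) (F G : List (Paren α)) : ℝ≥0∞ :=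
  if ted w F G ≤ k then ted w F G else ⊤

/-- The contexts `P` and `P'` are `ted^w_{≤ k}`-equivalent. -/
def TedEquivalent {α : Type*} (w : Weight α) (k : ℕ) (P P' : Context α) : Prop :=
  ∀ F G : List (Paren α), IsForest F → IsForest G →
    ∀ u v : ℕ × ℕ, P.OccursAt F u → P.OccursAt G v →
      |(u.1 : ℤ) - (v.1 : ℤ)| ≤ 2 * (k : ℤ) → |(u.2 : ℤ) - (v.2 : ℤ)| ≤ 2 * (k : ℤ) →
        tedLe w k F G = tedLe w k (P.replace P' F u) (P.replace P' G v)

end TreeEdit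

/-! By symmetry it is enough to turn an alignment of cost below k + 1/2 between two forests
containing P into a no more expensive one between the forests with P' in its place. The cost is half
a sum of weights, and every step other than a match of equal labels weighs at least 1. So such an
alignment makes at most 2k edits and never strays more than 2k from the main diagonal.

Locking (`exists_diagonal_points`). The nodes around the hole of P form a chain
(`exists_spineChain`). Consecutive ones are separated by one forest in each half, hence by at most
2·74k³ + 2 characters in all. Since |P| ≥ 578k⁴, some stretch of the chain with more than 64k³
characters in the two halves together meets no edit (`SpineChain.exists_stretch`). The alignment
translates the two sides of this stretch rigidly and sends its outermost node to a node of the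
second forest, which is compared with the copy of that node in the second occurrence of P. If their
openings agree, so do their closings, and the alignment passes through corresponding points in both
halves. Otherwise nesting makes both ends move inwards or both outwards, by amounts d, e > 0. Each
is at most 4k: 2k from the drift of the alignment and 2k from the offset of the occurrences. Along
the stretch the halves then have periods d and e, and enclosing nodes recur in steps of (d, e),
because nodes are matched with nodes (`spineCut_inward`, `spineCut_outward`). As (6k + 2)·8k ≤ 64k³,
there is room for 6k + 1 stacked copies of a context of size d + e, which P avoids (`not_avoids`).

Swap (`exists_isForestAlignment_replace`). Given points of the alignment on the diagonals of both
halves, the halves of P can be excised from both forests at no cost. Pairs of equal letters are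
removed one by one, starting at the diagonal point, and the triangle inequality pays for the
partners left behind (`matchCost_le_insert`). The halves of P' are then inserted and matched with
their copies for free. Nodes stay consistent because the halves of a context contain both ends of a
node or neither. -/

namespace TreeEdit

/-! ### Balanced strings via a stack -/

open Classical in
/-- Reads a string of parentheses with a stack of labels of open nodes. -/
noncomputable def readStack {α : Type*} : List (Paren α) → List α → Option (List α)
  | [], s => some s
  | Paren.opening a :: W, s => readStack W (a :: s)
  | Paren.closing _ :: _, [] => none
  | Paren.closing a :: W, b :: s => if a = b then readStack W s else none

section Forest

variable {α : Type*}

theorem readStack_append (X Y : List (Paren α)) (s : List α) :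
    readStack (X ++ Y) s = (readStack X s).bind (readStack Y) := by
  induction X generalizing s with
  | nil => rfl
  | cons x X ih =>
    cases x with
    | opening a => simp [readStack, ih]
    | closing a =>
      cases s with
      | nil => simp [readStack]
      | cons b s =>
        by_cases h : a = b <;> simp [readStack, ih, h]

theorem readStack_frame {W : List (Paren α)} {s t : List α} (r : List α)
    (h : readStack W s = some t) : readStack W (s ++ r) = some (t ++ r) := by
  induction W generalizing s with
  | nil => simp [readStack] at h ⊢; rw [h]
  | cons x W ih =>
    cases x with
    | opening a => exact ih (s := a :: s) h
    | closing a =>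
      cases s with
      | nil => simp [readStack] at h
      | cons b s =>
        by_cases hab : a = b
        · simp only [readStack, hab, if_true, List.cons_append] at h ⊢
          exact ih h
        · simp [readStack, hab] at h

theorem IsForest.readStack {F : List (Paren α)} (h : IsForest F) (s : List α) :
    readStack F s = some s := by
  induction h generalizing s with
  | nil => rfl
  | append hF hG ihF ihG => simp [readStack_append, ihF, ihG]
  | wrap a hF ih => simp [TreeEdit.readStack, readStack_append, ih]

/-- The string closes the open nodes of the given stack one after the other. -/
def ClosesStack : List α → List (Paren α) → Prop
  | [], W => IsForest W
  | a :: s, W => ∃ F W', IsForest F ∧ W = F ++ Paren.closing a :: W' ∧ ClosesStack s W'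

theorem ClosesStack.append {s : List α} {W T : List (Paren α)} (hT : IsForest T)
    (h : ClosesStack s W) : ClosesStack s (T ++ W) := by
  cases s with
  | nil => exact IsForest.append hT h
  | cons a s =>
    obtain ⟨F, W', hF, rfl, h⟩ := h
    exact ⟨T ++ F, W', hT.append hF, by simp, h⟩

/-- The stack is arbitrary so that the induction passes an opening parenthesis: with its label
pushed, the hypothesis yields the forest up to the matching closing parenthesis, which is wrapped
and absorbed into what follows. -/
theorem closesStack_of_readStack {W : List (Paren α)} {s : List α}
    (h : readStack W s = some []) : ClosesStack s W := by
  induction W generalizing s with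
  | nil =>
    simp only [readStack, Option.some.injEq] at h
    subst h
    exact IsForest.nil
  | cons x W ih =>
    cases x with
    | opening a =>
      obtain ⟨F, W', hF, rfl, h'⟩ := ih (s := a :: s) h
      have := h'.append (IsForest.wrap a hF)
      simpa using this
    | closing a =>
      cases s with
      | nil => simp [readStack] at h
      | cons b s =>
        by_cases hab : a = b
        · subst hab
          simp only [readStack, if_true] at h
          exact ⟨[], W, IsForest.nil, rfl, ih h⟩
        · simp [readStack, hab] at h

theorem isForest_iff_readStack {W : List (Paren α)} : IsForest W ↔ readStack W [] = some [] :=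
  ⟨fun h => h.readStack [], fun h => closesStack_of_readStack h⟩

/-- Reading a forest leaves every stack unchanged, so the reader cannot tell whether `Z` is there.
-/
theorem IsForest.remove {X Z Y : List (Paren α)} (h : IsForest (X ++ (Z ++ Y)))
    (hZ : IsForest Z) : IsForest (X ++ Y) := by
  rw [isForest_iff_readStack] at h ⊢
  simp only [readStack_append] at h ⊢
  rw [← h]
  congr 1
  funext s
  simp [hZ.readStack]

theorem isForest_insert_iff {X Z Y : List (Paren α)} (hZ : IsForest Z) :
    IsForest (X ++ (Z ++ Y)) ↔ IsForest (X ++ Y) :=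
  ⟨fun h => h.remove hZ, fun h => IsForest.insert_aux hZ h X Y rfl⟩

theorem isTree_cons_concat_iff {p q : Paren α} {W : List (Paren α)} :
    IsTree (p :: (W ++ [q])) ↔ IsForest W ∧ ∃ a, p = Paren.opening a ∧ q = Paren.closing a := by
  constructor
  · rintro ⟨a, F, hF, h⟩
    simp only [List.cons.injEq] at h
    obtain ⟨rfl, h⟩ := h
    obtain ⟨rfl, h2⟩ := List.append_inj' h rfl
    simp only [List.cons.injEq, and_true] at h2
    exact ⟨hF, a, rfl, h2⟩
  · rintro ⟨hW, a, rfl, rfl⟩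
    exact ⟨a, W, hW, rfl⟩

theorem isTree_insert_iff {X Z Y : List (Paren α)} (hZ : IsForest Z) (hX : X ≠ []) (hY : Y ≠ []) :
    IsTree (X ++ (Z ++ Y)) ↔ IsTree (X ++ Y) := by
  obtain ⟨x, X, rfl⟩ := List.exists_cons_of_ne_nil hX
  rcases List.eq_nil_or_concat Y with rfl | ⟨Y, y, rfl⟩
  · exact absurd rfl hY
  · have h1 : x :: X ++ (Z ++ Y.concat y) = x :: ((X ++ (Z ++ Y)) ++ [y]) := by simp
    have h2 : x :: X ++ (Y.concat y) = x :: ((X ++ Y) ++ [y]) := by simp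
    rw [h1, h2, isTree_cons_concat_iff, isTree_cons_concat_iff, isForest_insert_iff hZ]

/-- The label of the root stays at the bottom of the stack until the last character. -/
theorem IsTree.readStack_prefix {V W : List (Paren α)} (h : IsTree (V ++ W)) (hV : V ≠ [])
    (hW : W ≠ []) : ∃ s, s ≠ [] ∧ readStack V [] = some s := by
  obtain ⟨v, V, rfl⟩ := List.exists_cons_of_ne_nil hV
  rcases List.eq_nil_or_concat W with rfl | ⟨W, y, rfl⟩
  · exact absurd rfl hW
  · have h1 : v :: V ++ (W.concat y) = v :: ((V ++ W) ++ [y]) := by simp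
    rw [h1, isTree_cons_concat_iff] at h
    obtain ⟨hF, a, rfl, -⟩ := h
    have h2 := hF.readStack []
    rw [readStack_append] at h2
    cases h3 : readStack V [] with
    | none => simp [h3] at h2
    | some s =>
      refine ⟨s ++ [a], by simp, ?_⟩
      exact readStack_frame [a] h3

/-- The first tree needs an empty stack after `V`, but `V`, a nonempty proper prefix of the second
tree, leaves at least the root of that tree open. -/
theorem IsTree.not_crossing {U V W : List (Paren α)} (h1 : IsTree (U ++ V)) (h2 : IsTree (V ++ W))
    (hV : V ≠ []) (hW : W ≠ []) : False := by
  obtain ⟨s, hs, hVs⟩ := h2.readStack_prefix hV hW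
  have h := h1.isForest.readStack []
  rw [readStack_append] at h
  cases h3 : readStack U [] with
  | none => simp [h3] at h
  | some r =>
    rw [h3] at h
    have h4 := readStack_frame r hVs
    simp only [List.nil_append] at h4
    simp only [Option.bind_some, h4, Option.some.injEq, List.append_eq_nil_iff] at h
    exact hs h.1

theorem IsTree.eq_nil_of_suffix {U V : List (Paren α)} (h1 : IsTree (U ++ V)) (h2 : IsForest V)
    (hV : V ≠ []) : U = [] := by
  by_contra hU
  obtain ⟨s, hs, hUs⟩ := h1.readStack_prefix hU hV
  have h := h1.isForest.readStack []
  rw [readStack_append, hUs] at h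
  simp only [Option.bind_some, h2.readStack, Option.some.injEq] at h
  exact hs h

/-! ### Fragments -/

section Fragment

variable {β : Type*}

theorem getElem?_fragment (X : List β) (i j t : ℕ) :
    (fragment X i j)[t]? = if i + t < j then X[i + t]? else none := by
  simp [fragment, List.getElem?_drop, List.getElem?_take]

theorem length_fragment (X : List β) (i j : ℕ) :
    (fragment X i j).length = min j X.length - i := by
  simp [fragment]

theorem fragment_append_fragment (X : List β) {i j l : ℕ} (hij : i ≤ j) (hjl : j ≤ l)
    (hl : l ≤ X.length) : fragment X i j ++ fragment X j l = fragment X i l := by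
  apply List.ext_getElem?
  intro t
  rw [List.getElem?_append, length_fragment]
  simp only [getElem?_fragment]
  have : min j X.length = j := by omega
  rw [this]
  split_ifs with h1 h2 h3 h4 h5 h6 <;> first | rfl | omega | skip
  · congr 1; omega

theorem fragment_of_append (X W Y : List β) {o c : ℕ} (hc : c ≤ W.length) :
    fragment (X ++ (W ++ Y)) (X.length + o) (X.length + c) = fragment W o c := by
  apply List.ext_getElem?
  intro t
  simp only [getElem?_fragment]
  by_cases h : o + t < c
  · rw [if_pos (by omega), if_pos h, List.getElem?_append_right (by omega),
      List.getElem?_append_left (by omega)]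
    congr 1; omega
  · rw [if_neg (by omega), if_neg h]

theorem fragment_ne_nil {X : List β} {i j : ℕ} (hij : i < j) (hj : j ≤ X.length) :
    fragment X i j ≠ [] := by
  rw [← List.length_pos_iff, length_fragment]; omega

theorem fragment_zero_length (X : List β) : fragment X 0 X.length = X := by
  simp [fragment]

theorem fragment_length (X : List β) (i : ℕ) : fragment X i X.length = X.drop i := by
  simp [fragment]

theorem fragment_zero (X : List β) (j : ℕ) : fragment X 0 j = X.take j := by
  simp [fragment]

end Fragment

/-! ### Nodes -/

theorem nodes_nest {F : List (Paren α)} {o c o' c' : ℕ} (h : (o, c) ∈ nodes F)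
    (h' : (o', c') ∈ nodes F) (ho : o ≤ o') (hc : o' ≤ c) : c' ≤ c := by
  obtain ⟨h1, h2, h3⟩ := h
  obtain ⟨h1', h2', h3'⟩ := h'
  simp only at *
  by_contra hcc
  push Not at hcc
  rw [← fragment_append_fragment F (i := o) (j := o') (l := c + 1) ho (by omega) (by omega)] at h3
  rw [← fragment_append_fragment F (i := o') (j := c + 1) (l := c' + 1) (by omega) (by omega)
    (by omega)] at h3'
  exact h3.not_crossing h3' (fragment_ne_nil (by omega) (by omega))
    (fragment_ne_nil (by omega) (by omega))

theorem nodes_closing_unique {F : List (Paren α)} {o c c' : ℕ} (h : (o, c) ∈ nodes F)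
    (h' : (o, c') ∈ nodes F) : c = c' :=
  le_antisymm (nodes_nest h' h le_rfl h'.1.le) (nodes_nest h h' le_rfl h.1.le)

theorem nodes_opening_unique_aux {F : List (Paren α)} {o o' c : ℕ} (h : (o, c) ∈ nodes F)
    (h' : (o', c) ∈ nodes F) : o' ≤ o := by
  obtain ⟨h1, h2, h3⟩ := h
  obtain ⟨h1', h2', h3'⟩ := h'
  simp only at *
  by_contra hcc
  push Not at hcc
  rw [← fragment_append_fragment F (i := o) (j := o') (l := c + 1) (by omega) (by omega)
    (by omega)] at h3
  have := h3.eq_nil_of_suffix h3'.isForest (fragment_ne_nil (by omega) (by omega))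
  exact fragment_ne_nil (by omega) (by omega) this

theorem nodes_opening_unique {F : List (Paren α)} {o o' c : ℕ} (h : (o, c) ∈ nodes F)
    (h' : (o', c) ∈ nodes F) : o = o' :=
  le_antisymm (nodes_opening_unique_aux h' h) (nodes_opening_unique_aux h h')

theorem nodes_nest_lt {F : List (Paren α)} {o c o' c' : ℕ} (h : (o, c) ∈ nodes F)
    (h' : (o', c') ∈ nodes F) (ho : o < o') (hc : o' ≤ c) : c' < c := by
  refine lt_of_le_of_ne (nodes_nest h h' ho.le hc) ?_
  rintro rfl
  exact ho.ne (nodes_opening_unique h h')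

theorem nodes_letters {F : List (Paren α)} {o c : ℕ} (h : (o, c) ∈ nodes F) :
    ∃ a, F[o]? = some (Paren.opening a) ∧ F[c]? = some (Paren.closing a) := by
  obtain ⟨h1, h2, a, B, hB, h3⟩ := h
  simp only at *
  have hlen := congrArg List.length h3
  rw [length_fragment] at hlen
  simp only [List.length_cons, List.length_append, List.length_nil] at hlen
  refine ⟨a, ?_, ?_⟩
  · have := getElem?_fragment F o (c + 1) 0
    rw [h3, if_pos (by omega)] at this
    simpa using this.symm
  · have := getElem?_fragment F o (c + 1) (c - o)
    rw [h3, if_pos (by omega)] at this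
    rw [show o + (c - o) = c by omega] at this
    rw [← this, show c - o = B.length + 1 by omega]
    simp

theorem mem_nodes_append_iff (X W Y : List (Paren α)) {o c : ℕ} (hc : c < W.length) :
    (X.length + o, X.length + c) ∈ nodes (X ++ (W ++ Y)) ↔ (o, c) ∈ nodes W := by
  simp only [nodes, Set.mem_ofPred_eq, add_assoc]
  rw [fragment_of_append X W Y (show c + 1 ≤ W.length from hc)]
  simp only [List.length_append]
  constructor
  · rintro ⟨h1, -, h3⟩
    exact ⟨by omega, hc, h3⟩
  · rintro ⟨h1, -, h3⟩
    exact ⟨by omega, by omega, h3⟩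

theorem IsForest.exists_node {F : List (Paren α)} (hF : IsForest F) {i : ℕ} (hi : i < F.length) :
    ∃ o c, (o, c) ∈ nodes F ∧ (o = i ∨ c = i) := by
  induction hF generalizing i with
  | nil => simp at hi
  | @append F G hF hG ihF ihG =>
    by_cases h : i < F.length
    · obtain ⟨o, c, hu, h'⟩ := ihF h
      refine ⟨o, c, ?_, h'⟩
      have := (mem_nodes_append_iff [] F G hu.2.1).2 hu
      simpa using this
    · simp only [List.length_append] at hi
      obtain ⟨o, c, hu, h'⟩ := ihG (i := i - F.length) (by omega)
      refine ⟨F.length + o, F.length + c, ?_, by omega⟩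
      have := (mem_nodes_append_iff F G [] hu.2.1).2 hu
      simpa using this
  | @wrap a F hF ih =>
    simp only [List.length_cons, List.length_append, List.length_nil] at hi
    by_cases h : i = 0 ∨ i = F.length + 1
    · refine ⟨0, F.length + 1, ⟨by simp, by simp, a, F, hF, ?_⟩, by omega⟩
      simp [fragment]
    · obtain ⟨o, c, hu, h'⟩ := ih (i := i - 1) (by omega)
      refine ⟨1 + o, 1 + c, ?_, by omega⟩
      exact (mem_nodes_append_iff [Paren.opening a] F [Paren.closing a] hu.2.1).2 hu

/-- Every position of `W` has a partner inside `W`, which is still its partner in the whole string,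
and partners are unique. -/
theorem nodes_mem_forest_iff {X W Y : List (Paren α)} (hW : IsForest W) {o c : ℕ}
    (h : (o, c) ∈ nodes (X ++ (W ++ Y))) :
    (X.length ≤ o ∧ o < X.length + W.length) ↔ (X.length ≤ c ∧ c < X.length + W.length) := by
  have key : ∀ i, X.length ≤ i → i < X.length + W.length → (o = i ∨ c = i) →
      (X.length ≤ o ∧ c < X.length + W.length) := by
    intro i h1 h2 h3
    obtain ⟨o', c', hu, h'⟩ := hW.exists_node (i := i - X.length) (by omega)
    have hu' := (mem_nodes_append_iff X W Y hu.2.1).2 hu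
    have hlt := hu.2.1
    have hlt' := hu.1
    simp only at hlt hlt'
    obtain ⟨a, ha, hb⟩ := nodes_letters h
    obtain ⟨a', ha', hb'⟩ := nodes_letters hu'
    rcases h3 with rfl | rfl <;> rcases h' with h' | h'
    · have : X.length + o' = o := by omega
      rw [this] at hu'
      have := nodes_closing_unique h hu'
      omega
    · have : X.length + c' = o := by omega
      rw [this, ha] at hb'
      simp at hb'
    · have : X.length + o' = c := by omega
      rw [this, hb] at ha'
      simp at ha'
    · have : X.length + c' = c := by omega
      rw [this] at hu'
      have := nodes_opening_unique h hu'
      omega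
  have hoc := h.1
  simp only at hoc
  constructor
  · rintro ⟨h1, h2⟩
    have := key o h1 h2 (Or.inl rfl)
    omega
  · rintro ⟨h1, h2⟩
    have := key c h1 h2 (Or.inr rfl)
    omega

end Forest

/-! ### Alignments as paths indexed by time -/

/-- `q 0, …, q T` is an alignment of a string of length `n` onto one of length `n'`. -/
structure IsPath (q : ℕ → ℕ × ℕ) (T n n' : ℕ) : Prop where
  zero : q 0 = (0, 0)
  last : q T = (n, n')
  step : ∀ t < T, AlignStep (q t) (q (t + 1))

/-- The path aligns position `i` to position `j`. -/
def PathAligns (q : ℕ → ℕ × ℕ) (T i j : ℕ) : Prop :=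
  ∃ t < T, q t = (i, j) ∧ q (t + 1) = (i + 1, j + 1)

theorem isAlignment_iff_exists_path {A : List (ℕ × ℕ)} {n n' : ℕ} :
    IsAlignment A n n' ↔ ∃ q T, IsPath q T n n' ∧ A = (List.range (T + 1)).map q := by
  constructor
  · intro h
    have hne : A ≠ [] := by
      rintro rfl
      simpa using h.head
    have hlen := List.length_pos_iff.2 hne
    -- The default value `(0, 0)` only makes the function total; it is never read at times up to
    -- `A.length - 1`.
    refine ⟨fun t => A.getD t (0, 0), A.length - 1, ⟨?_, ?_, ?_⟩, ?_⟩
    · have := h.head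
      rw [List.head?_eq_getElem?] at this
      simp [List.getD_eq_getElem?_getD, this]
    · have := h.last
      rw [List.getLast?_eq_getElem?] at this
      simp [List.getD_eq_getElem?_getD, this]
    · intro t ht
      have := List.isChain_iff_getElem.1 h.chain t (by omega)
      simpa [List.getD_eq_getElem?_getD, List.getElem?_eq_getElem (show t < A.length by omega),
        List.getElem?_eq_getElem (show t + 1 < A.length by omega)] using this
    · apply List.ext_getElem
      · simp; omega
      · intro i h1 h2
        simp [List.getD_eq_getElem?_getD, h1]
  · rintro ⟨q, T, h, rfl⟩
    refine ⟨?_, ?_, ?_⟩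
    · simp [List.head?_eq_getElem?, h.zero]
    · simp [List.getLast?_eq_getElem?, h.last]
    · rw [List.isChain_iff_getElem]
      intro i hi
      simp only [List.length_map, List.length_range] at hi
      simpa using h.step i (by omega)

theorem pair_infix_path_iff {q : ℕ → ℕ × ℕ} {T : ℕ} {x y : ℕ × ℕ} :
    [x, y] <:+: (List.range (T + 1)).map q ↔ ∃ t < T, q t = x ∧ q (t + 1) = y := by
  rw [List.infix_iff_getElem?]
  constructor
  · rintro ⟨t, h1, h2⟩
    simp only [List.length_cons, List.length_nil, List.length_map, List.length_range] at h1 h2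
    have a := h2 0 (by omega)
    have b := h2 1 (by omega)
    refine ⟨t, by omega, ?_, ?_⟩
    · simpa [show t < T + 1 by omega] using a
    · rw [Nat.add_comm 1 t] at b
      simpa [show t < T by omega] using b
  · rintro ⟨t, ht, rfl, rfl⟩
    refine ⟨t, by simp; omega, ?_⟩
    intro i hi
    simp only [List.length_cons, List.length_nil] at hi
    have : i = 0 ∨ i = 1 := by omega
    rcases this with rfl | rfl
    · simp [show t < T + 1 by omega]
    · rw [Nat.add_comm 1 t]
      simp [show t < T by omega]

theorem edCost_path {β : Type*} (w : Weight β) (X Y : List β) (q : ℕ → ℕ × ℕ) (T : ℕ) :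
    edCost w X Y ((List.range (T + 1)).map q) =
      ∑ t ∈ Finset.range T, stepCost w X Y (q t) (q (t + 1)) := by
  have : ((List.range (T + 1)).map q).zip ((List.range (T + 1)).map q).tail =
      (List.range T).map fun t => (q t, q (t + 1)) := by
    apply List.ext_getElem
    · simp
    · intro i h1 h2
      simp
  rw [edCost, this, List.map_map, ← List.sum_toFinset _ List.nodup_range, List.toFinset_range]
  rfl

namespace IsPath

variable {q : ℕ → ℕ × ℕ} {T n n' : ℕ}

theorem le_of_le (h : IsPath q T n n') {s t : ℕ} (hst : s ≤ t) (ht : t ≤ T) :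
    (q s).1 ≤ (q t).1 ∧ (q s).2 ≤ (q t).2 := by
  induction t, hst using Nat.le_induction with
  | base => exact ⟨le_rfl, le_rfl⟩
  | succ t hst ih =>
    have h1 := ih (by omega)
    rcases h.step t (by omega) with h2 | h2 | h2 <;> rw [h2] <;> simp only <;> omega

theorem truncate (h : IsPath q T n n') {s : ℕ} (hs : s ≤ T) : IsPath q s (q s).1 (q s).2 :=
  ⟨h.zero, rfl, fun t ht => h.step t (by omega)⟩

theorem aligns_lt_iff (h : IsPath q T n n') {i j i' j' : ℕ} (h1 : PathAligns q T i j)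
    (h2 : PathAligns q T i' j') : i < i' ↔ j < j' := by
  obtain ⟨t, ht, a, b⟩ := h1
  obtain ⟨t', ht', a', b'⟩ := h2
  rcases lt_trichotomy t t' with h3 | h3 | h3
  · have := h.le_of_le (show t + 1 ≤ t' from h3) ht'.le
    rw [b, a'] at this
    simp only at this
    omega
  · subst h3
    rw [a] at a'
    simp only [Prod.mk.injEq] at a'
    omega
  · have := h.le_of_le (show t' + 1 ≤ t from h3) ht.le
    rw [b', a] at this
    simp only at this
    omega

theorem aligns_lt (h : IsPath q T n n') {i j : ℕ} (h1 : PathAligns q T i j) : i < n ∧ j < n' := by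
  obtain ⟨t, ht, a, b⟩ := h1
  have := h.le_of_le (show t + 1 ≤ T from ht) le_rfl
  rw [b, h.last] at this
  simp only at this
  omega

theorem exists_step_fst (h : IsPath q T n n') {i : ℕ} (hi : i < n) :
    ∃ t < T, (q t).1 = i ∧ (q (t + 1)).1 = i + 1 := by
  induction T generalizing n n' with
  | zero =>
    have h1 := h.last
    rw [h.zero] at h1
    simp only [Prod.mk.injEq] at h1
    omega
  | succ T ih =>
    by_cases h1 : i < (q T).1
    · obtain ⟨t, ht, h2⟩ := ih (h.truncate (Nat.le_succ T)) h1
      exact ⟨t, by omega, h2⟩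
    · have h2 := h.last
      have h3 := h.step T (by omega)
      refine ⟨T, by omega, ?_⟩
      rcases h3 with h3 | h3 | h3 <;> rw [h3] at h2 ⊢ <;> simp only [Prod.mk.injEq] at h2 ⊢ <;>
        omega

end IsPath

theorem IsAlignment.aligns_lt_iff {A : List (ℕ × ℕ)} {n n' : ℕ} (h : IsAlignment A n n')
    {i j i' j' : ℕ} (h1 : Aligns A i j) (h2 : Aligns A i' j') : i < i' ↔ j < j' := by
  obtain ⟨q, T, hq, rfl⟩ := isAlignment_iff_exists_path.1 h
  exact hq.aligns_lt_iff (pair_infix_path_iff.1 h1) (pair_infix_path_iff.1 h2)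

theorem IsAlignment.aligns_lt {A : List (ℕ × ℕ)} {n n' : ℕ} (h : IsAlignment A n n')
    {i j : ℕ} (h1 : Aligns A i j) : i < n ∧ j < n' := by
  obtain ⟨q, T, hq, rfl⟩ := isAlignment_iff_exists_path.1 h
  exact hq.aligns_lt (pair_infix_path_iff.1 h1)

theorem IsAlignment.deletes_or_aligns {A : List (ℕ × ℕ)} {n n' : ℕ} (h : IsAlignment A n n')
    {i : ℕ} (hi : i < n) : Deletes A i ∨ ∃ j, Aligns A i j := by
  obtain ⟨q, T, hq, rfl⟩ := isAlignment_iff_exists_path.1 h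
  obtain ⟨t, ht, h1, h2⟩ := hq.exists_step_fst hi
  rcases hq.step t ht with h3 | h3 | h3
  · right
    refine ⟨(q t).2, pair_infix_path_iff.2 ⟨t, ht, ?_, ?_⟩⟩
    · rw [← h1]
    · rw [h3, h1]
  · left
    refine ⟨(q t).2, pair_infix_path_iff.2 ⟨t, ht, ?_, ?_⟩⟩
    · rw [← h1]
    · rw [h3, h1]
  · rw [h3] at h2
    simp only at h2
    omega

theorem IsAlignment.not_deletes_of_aligns {A : List (ℕ × ℕ)} {n n' : ℕ} (h : IsAlignment A n n')
    {i j : ℕ} (h1 : Aligns A i j) : ¬ Deletes A i := by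
  rintro ⟨j', h2⟩
  obtain ⟨q, T, hq, rfl⟩ := isAlignment_iff_exists_path.1 h
  obtain ⟨t, ht, a, b⟩ := pair_infix_path_iff.1 h1
  obtain ⟨t', ht', a', b'⟩ := pair_infix_path_iff.1 h2
  rcases lt_trichotomy t t' with h3 | h3 | h3
  · have := hq.le_of_le (show t + 1 ≤ t' from h3) ht'.le
    rw [b, a'] at this
    simp only at this
    omega
  · subst h3
    rw [a] at a'
    rw [b] at b'
    simp only [Prod.mk.injEq] at a' b'
    omega
  · have := hq.le_of_le (show t' + 1 ≤ t from h3) ht.le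
    rw [b', a] at this
    simp only at this
    omega

/-! ### The cost of a matching -/

section MatchCost

variable {β : Type*} (w : Weight β) (f g : ℕ → Option β) (M : ℕ → ℕ → Prop)

open Classical in
/-- The cost of the matching `M` between the positions in `I` and those in `J`; positions without
a partner are deleted or inserted. -/
noncomputable def matchCost (I J : Finset ℕ) : ℝ≥0∞ :=
  (∑ i ∈ I, ∑ j ∈ J, if M i j then w (f i) (g j) else 0) +
    ((∑ i ∈ I, if ∃ j ∈ J, M i j then 0 else w (f i) none) +
      ∑ j ∈ J, if ∃ i ∈ I, M i j then 0 else w none (g j))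

variable {w f g M}

theorem matchCost_congr {f' g' : ℕ → Option β} {M' : ℕ → ℕ → Prop} {I J : Finset ℕ}
    (hf : ∀ i ∈ I, f i = f' i) (hg : ∀ j ∈ J, g j = g' j)
    (hM : ∀ i ∈ I, ∀ j ∈ J, (M i j ↔ M' i j)) :
    matchCost w f g M I J = matchCost w f' g' M' I J := by
  classical
  unfold matchCost
  congr 1
  · refine Finset.sum_congr rfl fun i hi => Finset.sum_congr rfl fun j hj => ?_
    rw [hf i hi, hg j hj]
    simp only [hM i hi j hj]
  · congr 1
    · refine Finset.sum_congr rfl fun i hi => ?_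
      rw [hf i hi]
      have : (∃ j ∈ J, M i j) ↔ ∃ j ∈ J, M' i j :=
        exists_congr fun j => and_congr_right fun hj => hM i hi j hj
      simp only [this]
    · refine Finset.sum_congr rfl fun j hj => ?_
      rw [hg j hj]
      have : (∃ i ∈ I, M i j) ↔ ∃ i ∈ I, M' i j :=
        exists_congr fun i => and_congr_right fun hi => hM i hi j hj
      simp only [this]

theorem matchCost_insert_deleted {I J : Finset ℕ} {p : ℕ} (hp : p ∉ I)
    (h : ∀ j ∈ J, ¬ M p j) :
    matchCost w f g M (insert p I) J = matchCost w f g M I J + w (f p) none := by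
  classical
  unfold matchCost
  rw [Finset.sum_insert hp, Finset.sum_insert hp]
  have h1 : (∑ j ∈ J, if M p j then w (f p) (g j) else 0) = 0 :=
    Finset.sum_eq_zero fun j hj => if_neg (h j hj)
  have h2 : ¬ ∃ j ∈ J, M p j := fun ⟨j, hj, hM⟩ => h j hj hM
  have h3 : (∑ j ∈ J, if ∃ i ∈ insert p I, M i j then 0 else w none (g j)) =
      ∑ j ∈ J, if ∃ i ∈ I, M i j then 0 else w none (g j) := by
    refine Finset.sum_congr rfl fun j hj => ?_
    simp [h j hj]
  rw [h1, if_neg h2, h3]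
  ring

theorem matchCost_insert_inserted {I J : Finset ℕ} {p : ℕ} (hp : p ∉ J)
    (h : ∀ i ∈ I, ¬ M i p) :
    matchCost w f g M I (insert p J) = matchCost w f g M I J + w none (g p) := by
  classical
  unfold matchCost
  rw [Finset.sum_insert hp]
  have h1 : ∀ i ∈ I, (∑ j ∈ insert p J, if M i j then w (f i) (g j) else 0) =
      ∑ j ∈ J, if M i j then w (f i) (g j) else 0 := by
    intro i hi
    rw [Finset.sum_insert hp, if_neg (h i hi), zero_add]
  have h2 : ¬ ∃ i ∈ I, M i p := fun ⟨i, hi, hM⟩ => h i hi hM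
  have h3 : (∑ i ∈ I, if ∃ j ∈ insert p J, M i j then 0 else w (f i) none) =
      ∑ i ∈ I, if ∃ j ∈ J, M i j then 0 else w (f i) none := by
    refine Finset.sum_congr rfl fun i hi => ?_
    simp [h i hi]
  rw [Finset.sum_congr rfl h1, if_neg h2, h3]
  ring

theorem matchCost_insert_aligned {I J : Finset ℕ} {p p' : ℕ} (hp : p ∉ I) (hp' : p' ∉ J)
    (hM : M p p') (h : ∀ j ∈ J, ¬ M p j) (h' : ∀ i ∈ I, ¬ M i p') :
    matchCost w f g M (insert p I) (insert p' J) = matchCost w f g M I J + w (f p) (g p') := by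
  classical
  unfold matchCost
  rw [Finset.sum_insert hp, Finset.sum_insert hp, Finset.sum_insert hp', Finset.sum_insert hp']
  have h1 : ∀ i ∈ I, (∑ j ∈ insert p' J, if M i j then w (f i) (g j) else 0) =
      ∑ j ∈ J, if M i j then w (f i) (g j) else 0 := by
    intro i hi
    rw [Finset.sum_insert hp', if_neg (h' i hi), zero_add]
  have h2 : (∑ j ∈ J, if M p j then w (f p) (g j) else 0) = 0 :=
    Finset.sum_eq_zero fun j hj => if_neg (h j hj)
  have h3 : (∑ j ∈ J, if ∃ i ∈ insert p I, M i j then 0 else w none (g j)) =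
      ∑ j ∈ J, if ∃ i ∈ I, M i j then 0 else w none (g j) := by
    refine Finset.sum_congr rfl fun j hj => ?_
    simp [h j hj]
  have h4 : (∑ i ∈ I, if ∃ j ∈ insert p' J, M i j then 0 else w (f i) none) =
      ∑ i ∈ I, if ∃ j ∈ J, M i j then 0 else w (f i) none := by
    refine Finset.sum_congr rfl fun i hi => ?_
    simp [h' i hi]
  rw [Finset.sum_congr rfl h1, h2, h3, h4, if_pos hM, if_pos ⟨p', by simp, hM⟩,
    if_pos ⟨p, by simp, hM⟩]
  ring

theorem matchCost_map {I J : Finset ℕ} {φ ψ : ℕ → ℕ} (hφ : Set.InjOn φ I)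
    (hψ : Set.InjOn ψ J) :
    matchCost w f g M (I.image φ) (J.image ψ) =
      matchCost w (f ∘ φ) (g ∘ ψ) (fun i j => M (φ i) (ψ j)) I J := by
  classical
  unfold matchCost
  rw [Finset.sum_image hφ, Finset.sum_image hφ, Finset.sum_image hψ]
  simp only [Finset.exists_mem_image, Function.comp]
  congr 1
  exact Finset.sum_congr rfl fun i hi => Finset.sum_image hψ

/-- Removing a pair of equal letters does not increase the cost, unless both are aligned to other
positions. -/
theorem matchCost_le_insert {I J : Finset ℕ} {p p' : ℕ} (hp : p ∉ I) (hp' : p' ∉ J)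
    (htri : ∀ a b c, w a c ≤ w a b + w b c) (hfg : f p = g p')
    (huI : ∀ i ∈ I, ∀ i' ∈ I, M i p' → M i' p' → i = i')
    (huJ : ∀ j ∈ J, ∀ j' ∈ J, M p j → M p j' → j = j')
    (hI : ∀ i ∈ I, M i p' → ∀ j ∈ insert p' J, ¬ M p j)
    (hJ : ∀ j ∈ J, M p j → ∀ i ∈ insert p I, ¬ M i p') :
    matchCost w f g M I J ≤ matchCost w f g M (insert p I) (insert p' J) := by
  classical
  unfold matchCost
  rw [Finset.sum_insert hp, Finset.sum_insert hp, Finset.sum_insert hp', Finset.sum_insert hp']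
  have e1 : (∑ i ∈ I, ∑ j ∈ insert p' J, if M i j then w (f i) (g j) else 0) =
      (∑ i ∈ I, if M i p' then w (f i) (g p') else 0) +
        ∑ i ∈ I, ∑ j ∈ J, if M i j then w (f i) (g j) else 0 := by
    rw [← Finset.sum_add_distrib]
    exact Finset.sum_congr rfl fun i hi => Finset.sum_insert hp'
  rw [e1]
  -- The old partner of `p'` becomes deleted. Its old match with `p'` plus the deletion of `p` pays
  -- for this, by the triangle inequality through `f p = g p'`; `hI` guarantees that `p` was indeed
  -- deleted.
  have hdel : (∑ i ∈ I, if ∃ j ∈ J, M i j then 0 else w (f i) none) ≤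
      (∑ i ∈ I, if M i p' then w (f i) (g p') else 0) +
        ((if ∃ j ∈ insert p' J, M p j then 0 else w (f p) none) +
        ∑ i ∈ I, if ∃ j ∈ insert p' J, M i j then 0 else w (f i) none) := by
    have hb : (∑ i ∈ I, if M i p' then w (g p') none else 0) ≤
        if ∃ j ∈ insert p' J, M p j then 0 else w (f p) none := by
      by_cases hex : ∃ i ∈ I, M i p'
      · obtain ⟨i, hi, hM⟩ := hex
        rw [Finset.sum_eq_single_of_mem i hi fun i' hi' hne => if_neg fun h =>
          hne (huI i' hi' i hi h hM), if_pos hM, if_neg, hfg]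
        rintro ⟨j, hj, h⟩
        exact hI i hi hM j hj h
      · rw [Finset.sum_eq_zero]
        · exact bot_le
        · intro i hi
          exact if_neg fun h => hex ⟨i, hi, h⟩
    calc _ ≤ ∑ i ∈ I, ((if M i p' then w (f i) (g p') else 0) +
          ((if M i p' then w (g p') none else 0) +
          if ∃ j ∈ insert p' J, M i j then 0 else w (f i) none)) := by
          refine Finset.sum_le_sum fun i hi => ?_
          by_cases h1 : ∃ j ∈ J, M i j
          · rw [if_pos h1]; exact bot_le
          · rw [if_neg h1]
            by_cases h2 : M i p'
            · rw [if_pos h2, if_pos h2, if_pos ⟨p', by simp, h2⟩, add_zero]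
              exact htri _ _ _
            · rw [if_neg h2, if_neg h2, if_neg, zero_add, zero_add]
              rintro ⟨j, hj, h3⟩
              rcases Finset.mem_insert.1 hj with rfl | hj
              · exact h2 h3
              · exact h1 ⟨j, hj, h3⟩
      _ ≤ _ := by
          rw [Finset.sum_add_distrib, Finset.sum_add_distrib]
          gcongr
  have hins : (∑ j ∈ J, if ∃ i ∈ I, M i j then 0 else w none (g j)) ≤
      (∑ j ∈ J, if M p j then w (f p) (g j) else 0) +
        ((if ∃ i ∈ insert p I, M i p' then 0 else w none (g p')) +
        ∑ j ∈ J, if ∃ i ∈ insert p I, M i j then 0 else w none (g j)) := by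
    have hb : (∑ j ∈ J, if M p j then w none (f p) else 0) ≤
        if ∃ i ∈ insert p I, M i p' then 0 else w none (g p') := by
      by_cases hex : ∃ j ∈ J, M p j
      · obtain ⟨j, hj, hM⟩ := hex
        rw [Finset.sum_eq_single_of_mem j hj fun j' hj' hne => if_neg fun h =>
          hne (huJ j' hj' j hj h hM), if_pos hM, if_neg, hfg]
        rintro ⟨i, hi, h⟩
        exact hJ j hj hM i hi h
      · rw [Finset.sum_eq_zero]
        · exact bot_le
        · intro j hj
          exact if_neg fun h => hex ⟨j, hj, h⟩
    calc _ ≤ ∑ j ∈ J, ((if M p j then w (f p) (g j) else 0) +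
          ((if M p j then w none (f p) else 0) +
          if ∃ i ∈ insert p I, M i j then 0 else w none (g j))) := by
          refine Finset.sum_le_sum fun j hj => ?_
          by_cases h1 : ∃ i ∈ I, M i j
          · rw [if_pos h1]; exact bot_le
          · rw [if_neg h1]
            by_cases h2 : M p j
            · rw [if_pos h2, if_pos h2, if_pos ⟨p, by simp, h2⟩, add_zero, add_comm]
              exact htri _ _ _
            · rw [if_neg h2, if_neg h2, if_neg, zero_add, zero_add]
              rintro ⟨i, hi, h3⟩
              rcases Finset.mem_insert.1 hi with rfl | hi
              · exact h2 h3
              · exact h1 ⟨i, hi, h3⟩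
      _ ≤ _ := by
          rw [Finset.sum_add_distrib, Finset.sum_add_distrib]
          gcongr
  calc _ ≤ _ := add_le_add le_rfl (add_le_add hdel hins)
    _ ≤ _ := by
      generalize (∑ i ∈ I, if M i p' then w (f i) (g p') else 0) = A
      generalize (∑ j ∈ J, if M p j then w (f p) (g j) else 0) = B
      generalize (∑ i ∈ I, ∑ j ∈ J, if M i j then w (f i) (g j) else 0) = C
      generalize (if M p p' then w (f p) (g p') else 0) = D
      generalize (if ∃ j ∈ insert p' J, M p j then 0 else w (f p) none) = E1
      generalize (if ∃ i ∈ insert p I, M i p' then 0 else w none (g p')) = E2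
      generalize (∑ i ∈ I, if ∃ j ∈ insert p' J, M i j then 0 else w (f i) none) = E3
      generalize (∑ j ∈ J, if ∃ i ∈ insert p I, M i j then 0 else w none (g j)) = E4
      calc C + (A + (E1 + E3) + (B + (E2 + E4))) ≤ D + (C + (A + (E1 + E3) + (B + (E2 + E4)))) :=
            le_add_self
        _ = _ := by ring

end MatchCost

/-- As a function of the set of matched pairs, the cost no longer depends on the order of deletions
and insertions, so alignments can be cut and spliced as matchings. -/
theorem IsPath.sum_stepCost {β : Type*} (w : Weight β) (X Y : List β) {q : ℕ → ℕ × ℕ}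
    {T n n' : ℕ} (h : IsPath q T n n') :
    ∑ t ∈ Finset.range T, stepCost w X Y (q t) (q (t + 1)) =
      matchCost w (fun i => X[i]?) (fun j => Y[j]?) (PathAligns q T) (Finset.range n)
        (Finset.range n') := by
  induction T generalizing n n' with
  | zero =>
    have h1 := h.last
    rw [h.zero] at h1
    simp only [Prod.mk.injEq] at h1
    obtain ⟨rfl, rfl⟩ := h1
    simp [matchCost]
  | succ T ih =>
    have hT := h.truncate (Nat.le_succ T)
    rw [Finset.sum_range_succ, ih hT]
    have hlast := h.last
    have hlt : ∀ {i j}, PathAligns q T i j → i < (q T).1 ∧ j < (q T).2 := fun h => hT.aligns_lt h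
    have hsucc : ∀ i j, PathAligns q (T + 1) i j ↔ PathAligns q T i j ∨
        (q T = (i, j) ∧ q (T + 1) = (i + 1, j + 1)) := by
      intro i j
      constructor
      · rintro ⟨t, ht, h1⟩
        rcases Nat.lt_succ_iff_lt_or_eq.1 ht with h2 | rfl
        · exact Or.inl ⟨t, h2, h1⟩
        · exact Or.inr h1
      · rintro (⟨t, ht, h1⟩ | h1)
        · exact ⟨t, by omega, h1⟩
        · exact ⟨T, by omega, h1⟩
    have hcongr : matchCost w (fun i => X[i]?) (fun j => Y[j]?) (PathAligns q T)
        (Finset.range (q T).1) (Finset.range (q T).2) =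
        matchCost w (fun i => X[i]?) (fun j => Y[j]?) (PathAligns q (T + 1))
        (Finset.range (q T).1) (Finset.range (q T).2) := by
      refine matchCost_congr (fun _ _ => rfl) (fun _ _ => rfl) fun i hi j hj => ?_
      rw [hsucc]
      refine ⟨Or.inl, ?_⟩
      rintro (h1 | ⟨h1, -⟩)
      · exact h1
      · rw [h1] at hi
        simp at hi
    rw [hcongr]
    rcases h.step T (Nat.lt_succ_self T) with h1 | h1 | h1
    · have hn : n = (q T).1 + 1 ∧ n' = (q T).2 + 1 := by
        rw [hlast] at h1; simpa using h1
      obtain ⟨rfl, rfl⟩ := hn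
      rw [Finset.range_add_one, Finset.range_add_one, matchCost_insert_aligned (by simp) (by simp)]
      · simp [stepCost, h1]
      · rw [hsucc]; exact Or.inr ⟨rfl, h1⟩
      · intro j hj h2
        simp only [Finset.mem_range] at hj
        rcases (hsucc _ _).1 h2 with h2 | ⟨h2, -⟩
        · have := hlt h2; omega
        · have := congrArg Prod.snd h2; simp only at this; omega
      · intro i hi h2
        simp only [Finset.mem_range] at hi
        rcases (hsucc _ _).1 h2 with h2 | ⟨h2, -⟩
        · have := hlt h2; omega
        · have := congrArg Prod.fst h2; simp only at this; omega
    · have hn : n = (q T).1 + 1 ∧ n' = (q T).2 := by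
        rw [hlast] at h1; simpa using h1
      obtain ⟨rfl, rfl⟩ := hn
      rw [Finset.range_add_one, matchCost_insert_deleted (by simp)]
      · simp [stepCost, h1]
      · intro j hj h2
        rcases (hsucc _ _).1 h2 with h2 | ⟨h3, h2⟩
        · have := hlt h2; omega
        · rw [h1] at h2
          have h3 := congrArg Prod.snd h3
          simp only [Prod.mk.injEq] at h2
          simp only at h3; omega
    · have hn : n = (q T).1 ∧ n' = (q T).2 + 1 := by
        rw [hlast] at h1; simpa using h1
      obtain ⟨rfl, rfl⟩ := hn
      rw [Finset.range_add_one, matchCost_insert_inserted (by simp)]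
      · simp [stepCost, h1]
      · intro i hi h2
        rcases (hsucc _ _).1 h2 with h2 | ⟨h3, h2⟩
        · have := hlt h2; omega
        · rw [h1] at h2
          have h3 := congrArg Prod.fst h3
          simp only [Prod.mk.injEq] at h2
          simp only at h3; omega

theorem IsAlignment.edCost_eq {β : Type*} (w : Weight β) (X Y : List β) {A : List (ℕ × ℕ)}
    {n n' : ℕ} (h : IsAlignment A n n') :
    edCost w X Y A = matchCost w (fun i => X[i]?) (fun j => Y[j]?) (Aligns A) (Finset.range n)
        (Finset.range n') := by
  obtain ⟨q, T, hq, rfl⟩ := isAlignment_iff_exists_path.1 h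
  rw [edCost_path, hq.sum_stepCost]
  exact matchCost_congr (fun _ _ => rfl) (fun _ _ => rfl) fun i hi j hj => pair_infix_path_iff.symm

/-- The path is traced back from its end. If `n - 1` is matched with `n' - 1`, the last step is
diagonal. If it is matched with a smaller position, monotonicity leaves `n' - 1` unmatched, and this
is inserted last. If it is unmatched, it is deleted last. -/
theorem exists_path_of_monotone {M : ℕ → ℕ → Prop}
    (hM : ∀ i j i' j', M i j → M i' j' → (i < i' ↔ j < j')) (n n' : ℕ) :
    ∃ q T, IsPath q T n n' ∧ ∀ i j, PathAligns q T i j ↔ M i j ∧ i < n ∧ j < n' := by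
  induction h : n + n' using Nat.strong_induction_on generalizing n n' with
  | _ m ih =>
  have extend : ∀ (q : ℕ → ℕ × ℕ) (T a b : ℕ), IsPath q T a b → AlignStep (a, b) (n, n') →
      (∀ i j, (PathAligns q T i j ∨ ((a, b) = (i, j) ∧ (n, n') = (i + 1, j + 1))) ↔
        M i j ∧ i < n ∧ j < n') →
      ∃ q T, IsPath q T n n' ∧ ∀ i j, PathAligns q T i j ↔ M i j ∧ i < n ∧ j < n' := by
    intro q T a b hq hs hMq
    let r : ℕ → ℕ × ℕ := fun t => if t ≤ T then q t else (n, n')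
    have hr : ∀ t, t ≤ T → r t = q t := fun t ht => if_pos ht
    have hr' : r (T + 1) = (n, n') := if_neg (by omega)
    refine ⟨r, T + 1, ⟨?_, hr', ?_⟩, ?_⟩
    · rw [hr 0 (by omega), hq.zero]
    · intro t ht
      rcases Nat.lt_succ_iff_lt_or_eq.1 ht with h2 | rfl
      · rw [hr t (by omega), hr (t + 1) (by omega)]
        exact hq.step t h2
      · rw [hr t le_rfl, hr', hq.last]
        exact hs
    · intro i j
      rw [← hMq]
      constructor
      · rintro ⟨t, ht, h1, h2⟩
        rcases Nat.lt_succ_iff_lt_or_eq.1 ht with h3 | rfl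
        · rw [hr t (by omega)] at h1
          rw [hr (t + 1) (by omega)] at h2
          exact Or.inl ⟨t, h3, h1, h2⟩
        · rw [hr t le_rfl, hq.last] at h1
          rw [hr'] at h2
          exact Or.inr ⟨h1, h2⟩
      · rintro (⟨t, ht, h1, h2⟩ | ⟨h1, h2⟩)
        · exact ⟨t, by omega, by rw [hr t (by omega), h1], by rw [hr (t + 1) (by omega), h2]⟩
        · exact ⟨T, by omega, by rw [hr T le_rfl, hq.last, h1], by rw [hr', h2]⟩
  by_cases h0 : n = 0 ∧ n' = 0
  · obtain ⟨rfl, rfl⟩ := h0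
    refine ⟨fun _ => (0, 0), 0, ⟨rfl, rfl, by simp⟩, ?_⟩
    intro i j
    simp [PathAligns]
  by_cases hd : ∃ j < n', M (n - 1) j
  · obtain ⟨j, hj, hMj⟩ := hd
    -- The conjunct `0 < n` guards against the truncated `n - 1 = 0` for `n = 0`, where only
    -- insertions remain.
    by_cases hj' : j = n' - 1 ∧ 0 < n
    · obtain ⟨hj1, hn⟩ := hj'
      obtain ⟨q, T, hq, hqM⟩ := ih (n - 1 + (n' - 1)) (by omega) (n - 1) (n' - 1) rfl
      refine extend q T _ _ hq (Or.inl (by simp; omega)) fun i j' => ?_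
      rw [hqM]
      simp only [Prod.mk.injEq]
      constructor
      · rintro (h1 | h1)
        · exact ⟨h1.1, by omega, by omega⟩
        · obtain ⟨⟨rfl, h2⟩, h3⟩ := h1
          rw [hj1, h2] at hMj
          exact ⟨hMj, by omega, by omega⟩
      · rintro ⟨h1, h2, h3⟩
        have := hM _ _ _ _ h1 hMj
        have := hM _ _ _ _ hMj h1
        by_cases h4 : i < n - 1
        · exact Or.inl ⟨h1, h4, by omega⟩
        · exact Or.inr (by omega)
    · obtain ⟨q, T, hq, hqM⟩ := ih (n + (n' - 1)) (by omega) n (n' - 1) rfl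
      refine extend q T _ _ hq (Or.inr (Or.inr (by simp; omega))) fun i j' => ?_
      rw [hqM]
      simp only [Prod.mk.injEq]
      constructor
      · rintro (h1 | h1)
        · exact ⟨h1.1, by omega, by omega⟩
        · omega
      · rintro ⟨h1, h2, h3⟩
        have := hM _ _ _ _ h1 hMj
        have := hM _ _ _ _ hMj h1
        exact Or.inl ⟨h1, h2, by omega⟩
  · by_cases hn : n = 0
    · subst hn
      obtain ⟨q, T, hq, hqM⟩ := ih (0 + (n' - 1)) (by omega) 0 (n' - 1) rfl
      refine extend q T _ _ hq (Or.inr (Or.inr (by simp; omega))) fun i j' => ?_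
      rw [hqM]
      simp
    · obtain ⟨q, T, hq, hqM⟩ := ih (n - 1 + n') (by omega) (n - 1) n' rfl
      refine extend q T _ _ hq (Or.inr (Or.inl (by simp; omega))) fun i j' => ?_
      rw [hqM]
      simp only [Prod.mk.injEq]
      constructor
      · rintro (h1 | h1)
        · exact ⟨h1.1, by omega, by omega⟩
        · omega
      · rintro ⟨h1, h2, h3⟩
        refine Or.inl ⟨h1, ?_, h3⟩
        by_contra h4
        have : i = n - 1 := by omega
        subst this
        exact hd ⟨j', h3, h1⟩

theorem exists_alignment_of_monotone {M : ℕ → ℕ → Prop}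
    (hM : ∀ i j i' j', M i j → M i' j' → (i < i' ↔ j < j')) (n n' : ℕ) :
    ∃ A, IsAlignment A n n' ∧ ∀ i j, Aligns A i j ↔ M i j ∧ i < n ∧ j < n' := by
  obtain ⟨q, T, hq, hqM⟩ := exists_path_of_monotone hM n n'
  exact ⟨_, isAlignment_iff_exists_path.2 ⟨q, T, hq, rfl⟩,
    fun i j => pair_infix_path_iff.trans (hqM i j)⟩

/-! ### Excising common blocks from a monotone matching -/

section MatchCost

variable {β : Type*} {w : Weight β} {f g : ℕ → Option β} {M : ℕ → ℕ → Prop}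

/-- Pairs are removed from the cut downwards, so the current pair is always the topmost one left
below the cut. Matches respect the cut; if both members of the pair had other partners, these would
lie further down, and the two matches would cross. So `matchCost_le_insert` applies. -/
theorem matchCost_sdiff_below {I J : Finset ℕ} {x y : ℕ}
    (htri : ∀ a b c, w a c ≤ w a b + w b c)
    (hM : ∀ i j i' j', M i j → M i' j' → (i < i' ↔ j < j'))
    (hcut : ∀ i j, M i j → (i < x ↔ j < y)) (t : ℕ) (htx : t ≤ x) (hty : t ≤ y)
    (hI : Finset.Ico (x - t) x ⊆ I) (hJ : Finset.Ico (y - t) y ⊆ J)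
    (hfg : ∀ s < t, f (x - (s + 1)) = g (y - (s + 1))) :
    matchCost w f g M (I \ Finset.Ico (x - t) x) (J \ Finset.Ico (y - t) y) ≤
      matchCost w f g M I J := by
  induction t with
  | zero => simp
  | succ t ih =>
    refine le_trans ?_ (ih (by omega) (by omega)
      (fun i hi => hI (by simp only [Finset.mem_Ico] at hi ⊢; omega))
      (fun i hi => hJ (by simp only [Finset.mem_Ico] at hi ⊢; omega))
      fun s hs => hfg s (by omega))
    have e1 : I \ Finset.Ico (x - t) x =
        insert (x - (t + 1)) (I \ Finset.Ico (x - (t + 1)) x) := by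
      ext i
      have := @hI i
      simp only [Finset.mem_sdiff, Finset.mem_insert, Finset.mem_Ico] at this ⊢
      constructor
      · rintro ⟨h1, h2⟩
        by_cases h3 : i = x - (t + 1)
        · exact Or.inl h3
        · exact Or.inr ⟨h1, by omega⟩
      · rintro (h1 | h1)
        · exact ⟨this (by omega), by omega⟩
        · exact ⟨h1.1, by omega⟩
    have e2 : J \ Finset.Ico (y - t) y =
        insert (y - (t + 1)) (J \ Finset.Ico (y - (t + 1)) y) := by
      ext i
      have := @hJ i
      simp only [Finset.mem_sdiff, Finset.mem_insert, Finset.mem_Ico] at this ⊢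
      constructor
      · rintro ⟨h1, h2⟩
        by_cases h3 : i = y - (t + 1)
        · exact Or.inl h3
        · exact Or.inr ⟨h1, by omega⟩
      · rintro (h1 | h1)
        · exact ⟨this (by omega), by omega⟩
        · exact ⟨h1.1, by omega⟩
    rw [e1, e2]
    refine matchCost_le_insert (by simp; omega) (by simp; omega) htri (hfg t (by omega))
      ?_ ?_ ?_ ?_
    · intro i _ i' _ h1 h2
      have := hM _ _ _ _ h1 h2
      have := hM _ _ _ _ h2 h1
      omega
    · intro i _ i' _ h1 h2
      have := hM _ _ _ _ h1 h2
      have := hM _ _ _ _ h2 h1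
      omega
    · intro i hi h1 j hj h2
      have := hM _ _ _ _ h1 h2
      have := hM _ _ _ _ h2 h1
      have := hcut _ _ h1
      have := hcut _ _ h2
      simp only [Finset.mem_sdiff, Finset.mem_insert, Finset.mem_Ico] at hi hj
      omega
    · intro j hj h1 i hi h2
      have := hM _ _ _ _ h1 h2
      have := hM _ _ _ _ h2 h1
      have := hcut _ _ h1
      have := hcut _ _ h2
      simp only [Finset.mem_sdiff, Finset.mem_insert, Finset.mem_Ico] at hi hj
      omega

theorem matchCost_sdiff_above {I J : Finset ℕ} {x y : ℕ}
    (htri : ∀ a b c, w a c ≤ w a b + w b c)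
    (hM : ∀ i j i' j', M i j → M i' j' → (i < i' ↔ j < j'))
    (hcut : ∀ i j, M i j → (i < x ↔ j < y)) (t : ℕ)
    (hI : Finset.Ico x (x + t) ⊆ I) (hJ : Finset.Ico y (y + t) ⊆ J)
    (hfg : ∀ s < t, f (x + s) = g (y + s)) :
    matchCost w f g M (I \ Finset.Ico x (x + t)) (J \ Finset.Ico y (y + t)) ≤
      matchCost w f g M I J := by
  induction t with
  | zero => simp
  | succ t ih =>
    refine le_trans ?_ (ih
      (fun i hi => hI (by simp only [Finset.mem_Ico] at hi ⊢; omega))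
      (fun i hi => hJ (by simp only [Finset.mem_Ico] at hi ⊢; omega))
      fun s hs => hfg s (by omega))
    have e1 : ∀ (I : Finset ℕ) (x : ℕ), Finset.Ico x (x + (t + 1)) ⊆ I →
        I \ Finset.Ico x (x + t) = insert (x + t) (I \ Finset.Ico x (x + (t + 1))) := by
      intro I x hI
      ext i
      have := @hI i
      simp only [Finset.mem_sdiff, Finset.mem_insert, Finset.mem_Ico] at this ⊢
      constructor
      · rintro ⟨h1, h2⟩
        by_cases h3 : i = x + t
        · exact Or.inl h3
        · exact Or.inr ⟨h1, by omega⟩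
      · rintro (h1 | h1)
        · exact ⟨this (by omega), by omega⟩
        · exact ⟨h1.1, by omega⟩
    rw [e1 I x hI, e1 J y hJ]
    refine matchCost_le_insert (by simp) (by simp) htri (hfg t (by omega))
      ?_ ?_ ?_ ?_
    · intro i _ i' _ h1 h2
      have := hM _ _ _ _ h1 h2
      have := hM _ _ _ _ h2 h1
      omega
    · intro i _ i' _ h1 h2
      have := hM _ _ _ _ h1 h2
      have := hM _ _ _ _ h2 h1
      omega
    · intro i hi h1 j hj h2
      have := hM _ _ _ _ h1 h2
      have := hM _ _ _ _ h2 h1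
      have := hcut _ _ h1
      have := hcut _ _ h2
      simp only [Finset.mem_sdiff, Finset.mem_insert, Finset.mem_Ico] at hi hj
      omega
    · intro j hj h1 i hi h2
      have := hM _ _ _ _ h1 h2
      have := hM _ _ _ _ h2 h1
      have := hcut _ _ h1
      have := hcut _ _ h2
      simp only [Finset.mem_sdiff, Finset.mem_insert, Finset.mem_Ico] at hi hj
      omega

/-- Removing a common block from both strings does not increase the cost of a monotone matching
that passes through a point on the diagonal of the block. -/
theorem matchCost_sdiff_block {I J : Finset ℕ} {x y s l : ℕ}
    (htri : ∀ a b c, w a c ≤ w a b + w b c)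
    (hM : ∀ i j i' j', M i j → M i' j' → (i < i' ↔ j < j')) (hs : s ≤ l)
    (hcut : ∀ i j, M i j → (i < x + s ↔ j < y + s))
    (hI : Finset.Ico x (x + l) ⊆ I) (hJ : Finset.Ico y (y + l) ⊆ J)
    (hfg : ∀ t < l, f (x + t) = g (y + t)) :
    matchCost w f g M (I \ Finset.Ico x (x + l)) (J \ Finset.Ico y (y + l)) ≤
      matchCost w f g M I J := by
  -- The cut at the diagonal point splits the block: the part before it is removed downwards, the
  -- part after it upwards, each starting next to the cut.
  have h1 := matchCost_sdiff_below (I := I) (J := J) (f := f) (g := g) htri hM hcut s (by omega)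
    (by omega)
    (fun i hi => hI (by simp only [Finset.mem_Ico] at hi ⊢; omega))
    (fun i hi => hJ (by simp only [Finset.mem_Ico] at hi ⊢; omega))
    (fun t ht => by
      rw [show x + s - (t + 1) = x + (s - (t + 1)) by omega,
        show y + s - (t + 1) = y + (s - (t + 1)) by omega]
      exact hfg _ (by omega))
  refine le_trans ?_ h1
  have h2 := matchCost_sdiff_above (f := f) (g := g) (I := I \ Finset.Ico (x + s - s) (x + s))
    (J := J \ Finset.Ico (y + s - s) (y + s)) htri hM hcut (l - s)
    (fun i hi => Finset.mem_sdiff.2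
      ⟨hI (by simp only [Finset.mem_Ico] at hi ⊢; omega),
        by simp only [Finset.mem_Ico] at hi ⊢; omega⟩)
    (fun i hi => Finset.mem_sdiff.2
      ⟨hJ (by simp only [Finset.mem_Ico] at hi ⊢; omega),
        by simp only [Finset.mem_Ico] at hi ⊢; omega⟩)
    (fun t ht => by
      rw [add_assoc, add_assoc]
      exact hfg _ (by omega))
  have e : ∀ (I : Finset ℕ) (x : ℕ), (I \ Finset.Ico (x + s - s) (x + s)) \
      Finset.Ico (x + s) (x + s + (l - s)) = I \ Finset.Ico x (x + l) := by
    intro I x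
    ext i
    simp only [Finset.mem_sdiff, Finset.mem_Ico, and_assoc]
    refine and_congr_right fun _ => ?_
    omega
  rw [e, e] at h2
  exact h2

/-- Positions all of whose matches are free do not contribute to the cost. -/
theorem matchCost_le_of_free {I I' J J' : Finset ℕ} (hI : I ⊆ I') (hJ : J ⊆ J')
    (h1 : ∀ i ∈ I', i ∉ I → ∃ j ∈ J', M i j) (h2 : ∀ j ∈ J', j ∉ J → ∃ i ∈ I', M i j)
    (h3 : ∀ i ∈ I', ∀ j ∈ J', M i j → i ∉ I ∨ j ∉ J → w (f i) (g j) = 0) :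
    matchCost w f g M I' J' ≤ matchCost w f g M I J := by
  classical
  unfold matchCost
  refine add_le_add (le_of_eq ?_) (add_le_add ?_ ?_)
  · symm
    have e : ∀ i ∈ I, (∑ j ∈ J, if M i j then w (f i) (g j) else 0) =
        ∑ j ∈ J', if M i j then w (f i) (g j) else 0 := by
      intro i hi
      refine Finset.sum_subset hJ fun j hj hj' => ?_
      split_ifs with h
      · exact h3 i (hI hi) j hj h (Or.inr hj')
      · rfl
    rw [Finset.sum_congr rfl e]
    refine Finset.sum_subset hI fun i hi hi' => Finset.sum_eq_zero fun j hj => ?_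
    split_ifs with h
    · exact h3 i hi j hj h (Or.inl hi')
    · rfl
  · rw [← Finset.sum_subset hI (f := fun i => if ∃ j ∈ J', M i j then 0 else w (f i) none)
      fun i hi hi' => if_pos (h1 i hi hi')]
    refine Finset.sum_le_sum fun i hi => ?_
    by_cases h : ∃ j ∈ J', M i j
    · rw [if_pos h]; exact bot_le
    · rw [if_neg h, if_neg]
      rintro ⟨j, hj, hij⟩
      exact h ⟨j, hJ hj, hij⟩
  · rw [← Finset.sum_subset hJ (f := fun j => if ∃ i ∈ I', M i j then 0 else w none (g j))
      fun j hj hj' => if_pos (h2 j hj hj')]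
    refine Finset.sum_le_sum fun j hj => ?_
    by_cases h : ∃ i ∈ I', M i j
    · rw [if_pos h]; exact bot_le
    · rw [if_neg h, if_neg]
      rintro ⟨i, hi, hij⟩
      exact h ⟨i, hI hi, hij⟩

end MatchCost

/-! ### Strings around a context -/

/-- The string `X · L · H · R · Y`. -/
def plug {β : Type*} (X L H R Y : List β) : List β := X ++ (L ++ (H ++ (R ++ Y)))

/-- Position `i` of `X · L · H · R · Y` lies in `L` or in `R`, where `|X| = x`, `|L| = a`,
`|H| = h`, `|R| = b`. -/
def InHalves (x a h b i : ℕ) : Prop :=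
  (x ≤ i ∧ i < x + a) ∨ (x + a + h ≤ i ∧ i < x + a + h + b)

/-- How a position outside of `L` and `R` moves when the lengths `a`, `b` of `L`, `R` become
`a'`, `b'`. -/
def movePos (x a h b a' b' i : ℕ) : ℕ :=
  if i < x then i else if i < x + a + h then i - a + a' else i - a - b + a' + b'

section Plug

theorem length_plug {β : Type*} (X L H R Y : List β) :
    (plug X L H R Y).length = X.length + L.length + H.length + R.length + Y.length := by
  simp [plug]; omega

theorem getElem?_plug_left {β : Type*} (X L H R Y : List β) {i : ℕ} (hi : i < L.length) :
    (plug X L H R Y)[X.length + i]? = L[i]? := by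
  simp [plug, List.getElem?_append, hi]

theorem getElem?_plug_right {β : Type*} (X L H R Y : List β) {i : ℕ} (hi : i < R.length) :
    (plug X L H R Y)[X.length + L.length + H.length + i]? = R[i]? := by
  rw [plug, ← List.append_assoc, ← List.append_assoc, List.getElem?_append_right (by simp; omega),
    List.getElem?_append_left (by simp; omega)]
  congr 1; simp; omega

theorem getElem?_plug_movePos {β : Type*} (X L H R Y L' R' : List β) {i : ℕ}
    (hi : ¬ InHalves X.length L.length H.length R.length i) :
    (plug X L' H R' Y)[movePos X.length L.length H.length R.length L'.length R'.length i]? =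
      (plug X L H R Y)[i]? := by
  unfold InHalves at hi
  unfold movePos plug
  simp only [List.getElem?_append]
  split_ifs <;> first | rfl | omega | (congr 1; omega)

variable {α : Type*} {X L H R Y : List (Paren α)}

theorem mem_nodes_plug_left_iff {i j : ℕ} (hj : j < L.length) :
    (X.length + i, X.length + j) ∈ nodes (plug X L H R Y) ↔ (i, j) ∈ nodes L :=
  mem_nodes_append_iff X L _ hj

theorem mem_nodes_plug_right_iff {i j : ℕ} (hj : j < R.length) :
    (X.length + L.length + H.length + i, X.length + L.length + H.length + j) ∈
      nodes (plug X L H R Y) ↔ (i, j) ∈ nodes R := by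
  have := mem_nodes_append_iff (X ++ (L ++ H)) R Y (o := i) hj
  simp only [List.length_append, List.append_assoc] at this
  rw [plug, ← this, add_assoc X.length]

theorem mem_nodes_plug_hole_iff {i j : ℕ} (hj : j < H.length) :
    (X.length + L.length + i, X.length + L.length + j) ∈
      nodes (plug X L H R Y) ↔ (i, j) ∈ nodes H := by
  have := mem_nodes_append_iff (X ++ L) H (R ++ Y) (o := i) hj
  simp only [List.length_append, List.append_assoc] at this
  rw [plug, ← this]

theorem mem_nodes_spanning_iff {U V W : List (Paren α)} (hV : IsForest V) {i j : ℕ}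
    (hi : i < U.length) (hj : j < W.length) :
    (i, U.length + V.length + j) ∈ nodes (U ++ (V ++ W)) ↔
      IsTree (U.drop i ++ W.take (j + 1)) := by
  have e : fragment (U ++ (V ++ W)) i (U.length + V.length + j + 1) =
      U.drop i ++ (V ++ W.take (j + 1)) := by
    apply List.ext_getElem?
    intro t
    simp only [getElem?_fragment, List.getElem?_append, List.getElem?_drop, List.getElem?_take,
      List.length_drop]
    split_ifs <;> first | rfl | omega | (congr 1; omega)
  simp only [nodes, Set.mem_ofPred_eq, e, List.length_append]
  rw [isTree_insert_iff hV]
  · exact ⟨fun h => h.2.2, fun h => ⟨by omega, by omega, h⟩⟩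
  · rw [← List.length_pos_iff]; simp; omega
  · rw [← List.length_pos_iff]; simp; omega

theorem mem_nodes_plug_spine_iff (hH : IsForest H) {i j : ℕ} (hi : i < L.length)
    (hj : j < R.length) :
    (X.length + i, X.length + L.length + H.length + j) ∈ nodes (plug X L H R Y) ↔
      IsTree (L.drop i ++ R.take (j + 1)) := by
  have h := mem_nodes_append_iff X (L ++ (H ++ R)) Y (o := i)
    (c := L.length + H.length + j) (by simp; omega)
  rw [← mem_nodes_spanning_iff hH hi hj, ← h, plug]
  simp only [List.append_assoc, add_assoc]

/-- The halves are the difference of two balanced substrings, the block `L ++ (H ++ R)` and the hole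
`H`, and a balanced substring contains both ends of a node or neither. -/
theorem nodes_plug_halves_iff (hH : IsForest H) (hT : IsForest (L ++ (H ++ R))) {o c : ℕ}
    (h : (o, c) ∈ nodes (plug X L H R Y)) :
    InHalves X.length L.length H.length R.length o ↔
      InHalves X.length L.length H.length R.length c := by
  have h1 := nodes_mem_forest_iff (X := X ++ L) (W := H) (Y := R ++ Y) hH (o := o) (c := c)
    (by simpa [plug] using h)
  have h2 := nodes_mem_forest_iff (X := X) (W := L ++ (H ++ R)) (Y := Y) hT (o := o) (c := c)
    (by simpa [plug] using h)
  simp only [List.length_append] at h1 h2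
  unfold InHalves
  omega

/-- A node avoiding the halves lies around the block, before it, in the hole, or after it. Only in
the first case does its fragment contain the block, and exchanging one forest for another inside
does not affect whether it is a tree. -/
theorem mem_nodes_plug_movePos_iff {L' R' : List (Paren α)} (hH : IsForest H)
    (hT : IsForest (L ++ (H ++ R))) (hT' : IsForest (L' ++ (H ++ R'))) {o c : ℕ}
    (ho : ¬ InHalves X.length L.length H.length R.length o)
    (hc : ¬ InHalves X.length L.length H.length R.length c)
    (hcl : c < (plug X L H R Y).length) :
    (movePos X.length L.length H.length R.length L'.length R'.length o,
      movePos X.length L.length H.length R.length L'.length R'.length c) ∈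
        nodes (plug X L' H R' Y) ↔ (o, c) ∈ nodes (plug X L H R Y) := by
  by_cases hpart : o < c ∧ ((o < X.length ∧ X.length + L.length + H.length + R.length ≤ c) ∨
      (c < X.length) ∨ (X.length + L.length ≤ o ∧ c < X.length + L.length + H.length) ∨
      (X.length + L.length + H.length + R.length ≤ o))
  · rw [length_plug] at hcl
    obtain ⟨hoc, h | h | h | h⟩ := hpart
    · have e1 : movePos X.length L.length H.length R.length L'.length R'.length o = o :=
        if_pos h.1
      have e2 : movePos X.length L.length H.length R.length L'.length R'.length c =
          X.length + (L' ++ (H ++ R')).length + (c - X.length - (L ++ (H ++ R)).length) := by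
        unfold movePos
        simp only [List.length_append]
        split_ifs <;> omega
      have e3 : c = X.length + (L ++ (H ++ R)).length +
          (c - X.length - (L ++ (H ++ R)).length) := by
        simp only [List.length_append]; omega
      have hj : c - X.length - (L ++ (H ++ R)).length < Y.length := by
        simp only [List.length_append]; omega
      rw [e1, e2]
      have k1 := mem_nodes_spanning_iff (U := X) (W := Y) hT' h.1 hj
      have k2 := mem_nodes_spanning_iff (U := X) (W := Y) hT h.1 hj
      rw [← e3] at k2
      simp only [List.append_assoc] at k1 k2
      unfold plug
      rw [k1, k2]
    · have e1 : movePos X.length L.length H.length R.length L'.length R'.length o = o :=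
        if_pos (by omega)
      have e2 : movePos X.length L.length H.length R.length L'.length R'.length c = c :=
        if_pos (by omega)
      rw [e1, e2]
      have k1 := mem_nodes_append_iff [] X (L ++ (H ++ (R ++ Y))) (o := o) h
      have k2 := mem_nodes_append_iff [] X (L' ++ (H ++ (R' ++ Y))) (o := o) h
      simp only [List.length_nil, zero_add, List.nil_append] at k1 k2
      unfold plug
      rw [k1, k2]
    · have e1 : movePos X.length L.length H.length R.length L'.length R'.length o =
          X.length + L'.length + (o - (X.length + L.length)) := by
        unfold movePos; split_ifs <;> omega
      have e2 : movePos X.length L.length H.length R.length L'.length R'.length c =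
          X.length + L'.length + (c - (X.length + L.length)) := by
        unfold movePos; split_ifs <;> omega
      obtain ⟨o, rfl⟩ := Nat.exists_eq_add_of_le h.1
      obtain ⟨c, rfl⟩ := Nat.exists_eq_add_of_le (show X.length + L.length ≤ c by omega)
      rw [e1, e2, mem_nodes_plug_hole_iff (by omega), mem_nodes_plug_hole_iff (by omega)]
      simp
    · have e1 : movePos X.length L.length H.length R.length L'.length R'.length o =
          (X ++ (L' ++ (H ++ R'))).length + (o - (X ++ (L ++ (H ++ R))).length) := by
        unfold movePos; simp only [List.length_append]; split_ifs <;> omega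
      have e2 : movePos X.length L.length H.length R.length L'.length R'.length c =
          (X ++ (L' ++ (H ++ R'))).length + (c - (X ++ (L ++ (H ++ R))).length) := by
        unfold movePos; simp only [List.length_append]; split_ifs <;> omega
      have e3 : (X ++ (L ++ (H ++ R))).length + (o - (X ++ (L ++ (H ++ R))).length) = o := by
        simp only [List.length_append]; omega
      have e4 : (X ++ (L ++ (H ++ R))).length + (c - (X ++ (L ++ (H ++ R))).length) = c := by
        simp only [List.length_append]; omega
      rw [e1, e2]
      have hj : c - (X ++ (L ++ (H ++ R))).length < Y.length := by
        simp only [List.length_append]; omega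
      have k1 := mem_nodes_append_iff (X ++ (L ++ (H ++ R))) Y []
        (o := o - (X ++ (L ++ (H ++ R))).length) hj
      have k2 := mem_nodes_append_iff (X ++ (L' ++ (H ++ R'))) Y []
        (o := o - (X ++ (L ++ (H ++ R))).length) hj
      rw [e3, e4] at k1
      unfold plug
      simp only [List.append_assoc, List.append_nil] at k1 k2
      rw [k1, k2]
  -- Outside these four positions neither pair can be a node, because the hole and the block are
  -- balanced for either context.
  · have key : ∀ (L R : List (Paren α)), IsForest (L ++ (H ++ R)) → ∀ o c,
        ¬ InHalves X.length L.length H.length R.length o →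
        ¬ InHalves X.length L.length H.length R.length c →
        (o, c) ∈ nodes (plug X L H R Y) →
        o < c ∧ ((o < X.length ∧ X.length + L.length + H.length + R.length ≤ c) ∨
        (c < X.length) ∨ (X.length + L.length ≤ o ∧ c < X.length + L.length + H.length) ∨
        (X.length + L.length + H.length + R.length ≤ o)) := by
      intro L R hT o c ho hc h
      have h1 := nodes_mem_forest_iff (X := X ++ L) (W := H) (Y := R ++ Y) hH (o := o) (c := c)
        (by simpa [plug] using h)
      have h2 := nodes_mem_forest_iff (X := X) (W := L ++ (H ++ R)) (Y := Y) hT (o := o) (c := c)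
        (by simpa [plug] using h)
      have h3 := h.1
      simp only [List.length_append] at h1 h2 h3
      unfold InHalves at ho hc
      omega
    constructor
    · intro h
      exfalso
      have h1 := key L' R' hT' _ _ ?_ ?_ h
      · apply hpart
        unfold InHalves at ho hc
        unfold movePos at h1
        split_ifs at h1 <;> omega
      · unfold InHalves movePos at *
        split_ifs <;> omega
      · unfold InHalves movePos at *
        split_ifs <;> omega
    · intro h
      exact absurd (key L R hT _ _ ho hc h) hpart

/-- Corresponding positions in the halves of a context around different holes bound nodes
simultaneously. -/
theorem exists_node_plug_of_halves {X' H' Y' : List (Paren α)} (hH : IsForest H)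
    (hH' : IsForest H') (hT : IsForest (L ++ (H ++ R))) {o c : ℕ}
    (h : (o, c) ∈ nodes (plug X L H R Y))
    (ho : InHalves X.length L.length H.length R.length o) :
    ∃ o' c', (o', c') ∈ nodes (plug X' L H' R Y') ∧
      (∀ e e', (e = o ∧ e' = o') ∨ (e = c ∧ e' = c') →
        (∃ s < L.length, e = X.length + s ∧ e' = X'.length + s) ∨
        ∃ s < R.length, e = X.length + L.length + H.length + s ∧
          e' = X'.length + L.length + H'.length + s) := by
  have hc := (nodes_plug_halves_iff hH hT h).1 ho
  have hoc := h.1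
  simp only at hoc
  rcases ho with ho | ho <;> rcases hc with hc | hc
  · obtain ⟨i, rfl⟩ := Nat.exists_eq_add_of_le ho.1
    obtain ⟨j, rfl⟩ := Nat.exists_eq_add_of_le hc.1
    rw [mem_nodes_plug_left_iff (by omega)] at h
    refine ⟨X'.length + i, X'.length + j, (mem_nodes_plug_left_iff (by omega)).2 h, ?_⟩
    rintro e e' (⟨rfl, rfl⟩ | ⟨rfl, rfl⟩)
    · exact Or.inl ⟨i, by omega, rfl, rfl⟩
    · exact Or.inl ⟨j, by omega, rfl, rfl⟩
  · obtain ⟨i, rfl⟩ := Nat.exists_eq_add_of_le ho.1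
    obtain ⟨j, rfl⟩ := Nat.exists_eq_add_of_le hc.1
    rw [mem_nodes_plug_spine_iff hH (by omega) (by omega)] at h
    refine ⟨X'.length + i, X'.length + L.length + H'.length + j,
      (mem_nodes_plug_spine_iff hH' (by omega) (by omega)).2 h, ?_⟩
    rintro e e' (⟨rfl, rfl⟩ | ⟨rfl, rfl⟩)
    · exact Or.inl ⟨i, by omega, rfl, rfl⟩
    · exact Or.inr ⟨j, by omega, rfl, rfl⟩
  · omega
  · obtain ⟨i, rfl⟩ := Nat.exists_eq_add_of_le ho.1
    obtain ⟨j, rfl⟩ := Nat.exists_eq_add_of_le hc.1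
    rw [mem_nodes_plug_right_iff (by omega)] at h
    refine ⟨X'.length + L.length + H'.length + i, X'.length + L.length + H'.length + j,
      (mem_nodes_plug_right_iff (by omega)).2 h, ?_⟩
    rintro e e' (⟨rfl, rfl⟩ | ⟨rfl, rfl⟩)
    · exact Or.inr ⟨i, by omega, rfl, rfl⟩
    · exact Or.inr ⟨j, by omega, rfl, rfl⟩

end Plug

/-! ### Replacing a context inside an alignment -/

section Replace

/-- The matching after the replacement of a context: pairs outside of the context are kept, and
the halves of the new context are matched with each other. -/
def ReplacedMatching (M : ℕ → ℕ → Prop) (x x' a h h' b a' b' : ℕ) (p q : ℕ) : Prop :=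
  (∃ i j, M i j ∧ ¬ InHalves x a h b i ∧ ¬ InHalves x' a h' b j ∧
    p = movePos x a h b a' b' i ∧ q = movePos x' a h' b a' b' j) ∨
  (∃ s < a', p = x + s ∧ q = x' + s) ∨ ∃ s < b', p = x + a' + h + s ∧ q = x' + a' + h' + s

variable {M : ℕ → ℕ → Prop} {x x' a h h' b a' b' : ℕ}

theorem movePos_cases {i : ℕ} (hi : ¬ InHalves x a h b i) :
    (i < x ∧ movePos x a h b a' b' i = i) ∨
      (x + a ≤ i ∧ i < x + a + h ∧ movePos x a h b a' b' i + a = i + a') ∨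
      (x + a + h + b ≤ i ∧ movePos x a h b a' b' i + a + b = i + a' + b') := by
  unfold InHalves at hi
  unfold movePos
  split_ifs <;> omega

theorem not_inHalves_movePos {i : ℕ} (hi : ¬ InHalves x a h b i) :
    ¬ InHalves x a' h b' (movePos x a h b a' b' i) := by
  unfold InHalves movePos at *
  split_ifs <;> omega

theorem movePos_injective {i j : ℕ} (hi : ¬ InHalves x a h b i) (hj : ¬ InHalves x a h b j)
    (hij : movePos x a h b a' b' i = movePos x a h b a' b' j) : i = j := by
  unfold InHalves movePos at *
  split_ifs at hij <;> omega

theorem exists_movePos_eq {p y : ℕ} (hp : ¬ InHalves x a' h b' p)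
    (hy : p < x + a' + h + b' + y) :
    ∃ i < x + a + h + b + y, ¬ InHalves x a h b i ∧ movePos x a h b a' b' i = p := by
  unfold InHalves at hp
  by_cases h1 : p < x
  · refine ⟨p, by omega, ?_, ?_⟩
    · unfold InHalves; omega
    · unfold movePos; split_ifs; omega
  · by_cases h2 : p < x + a' + h
    · refine ⟨p - a' + a, by omega, ?_, ?_⟩
      · unfold InHalves; omega
      · unfold movePos; split_ifs <;> omega
    · refine ⟨p - a' - b' + a + b, by omega, ?_, ?_⟩
      · unfold InHalves; omega
      · unfold movePos; split_ifs <;> omega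

/-- A cut in each half forces a kept pair into the same zone of both strings: before the context, in
its hole, or after it. On each zone `movePos` is a translation, and the new diagonal blocks fit
between the zones. -/
theorem replacedMatching_lt_iff
    (hM : ∀ i j i' j', M i j → M i' j' → (i < i' ↔ j < j'))
    (hc1 : ∃ s ≤ a, ∀ i j, M i j → (i < x + s ↔ j < x' + s))
    (hc2 : ∃ s ≤ b, ∀ i j, M i j → (i < x + a + h + s ↔ j < x' + a + h' + s)) :
    ∀ i j i' j', ReplacedMatching M x x' a h h' b a' b' i j →
      ReplacedMatching M x x' a h h' b a' b' i' j' → (i < i' ↔ j < j') := by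
  obtain ⟨s, hs, hc1⟩ := hc1
  obtain ⟨s', hs', hc2⟩ := hc2
  have key : ∀ i j, M i j → ¬ InHalves x a h b i → ¬ InHalves x' a h' b j →
      (movePos x a h b a' b' i < x ∧ movePos x a h b a' b' i = i ∧
        movePos x' a h' b a' b' j < x' ∧ movePos x' a h' b a' b' j = j) ∨
      (x + a' ≤ movePos x a h b a' b' i ∧ movePos x a h b a' b' i < x + a' + h ∧
        movePos x a h b a' b' i + a = i + a' ∧
        x' + a' ≤ movePos x' a h' b a' b' j ∧ movePos x' a h' b a' b' j < x' + a' + h' ∧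
        movePos x' a h' b a' b' j + a = j + a') ∨
      (x + a' + h + b' ≤ movePos x a h b a' b' i ∧
        movePos x a h b a' b' i + a + b = i + a' + b' ∧
        x' + a' + h' + b' ≤ movePos x' a h' b a' b' j ∧
        movePos x' a h' b a' b' j + a + b = j + a' + b') := by
    intro i j hij hi hj
    have k1 := hc1 i j hij
    have k2 := hc2 i j hij
    have m1 := movePos_cases (a' := a') (b' := b') hi
    have m2 := movePos_cases (a' := a') (b' := b') hj
    generalize movePos x a h b a' b' i = m at *
    generalize movePos x' a h' b a' b' j = m' at *
    clear hi hj
    rcases m1 with m1 | m1 | m1 <;> rcases m2 with m2 | m2 | m2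
    · exact Or.inl (by omega)
    · omega
    · omega
    · omega
    · exact Or.inr (Or.inl (by omega))
    · omega
    · omega
    · omega
    · exact Or.inr (Or.inr (by omega))
  rintro i j i' j' (⟨p, q, h1, h2, h3, rfl, rfl⟩ | ⟨t, ht, rfl, rfl⟩ | ⟨t, ht, rfl, rfl⟩)
    (⟨p', q', h1', h2', h3', rfl, rfl⟩ | ⟨t', ht', rfl, rfl⟩ | ⟨t', ht', rfl, rfl⟩)
  · have k1 := key _ _ h1 h2 h3
    have k2 := key _ _ h1' h2' h3'
    have := hM _ _ _ _ h1 h1'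
    rcases k1 with k1 | k1 | k1 <;> rcases k2 with k2 | k2 | k2 <;> omega
  · have k1 := key _ _ h1 h2 h3
    omega
  · have k1 := key _ _ h1 h2 h3
    omega
  · have k1 := key _ _ h1' h2' h3'
    omega
  · omega
  · omega
  · have k1 := key _ _ h1' h2' h3'
    omega
  · omega
  · omega

end Replace

theorem IsNormalizedQuasimetric.parenWeight_self {α : Type*} {w : Weight α}
    (hw : IsNormalizedQuasimetric w) (p : Option (Paren α)) : parenWeight w p p = 0 :=
  hw.self _

theorem IsNormalizedQuasimetric.parenWeight_triangle {α : Type*} {w : Weight α}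
    (hw : IsNormalizedQuasimetric w) (p q r : Option (Paren α)) :
    parenWeight w p r ≤ parenWeight w p q + parenWeight w q r :=
  hw.triangle _ _ _

/-- If an alignment passes through diagonal points in both halves of a common context, the context
can be replaced at no cost. -/
theorem exists_isForestAlignment_replace {α : Type*} {w : Weight α}
    (hw : IsNormalizedQuasimetric w) {X L H R Y X' H' Y' L' R' : List (Paren α)}
    (hH : IsForest H) (hH' : IsForest H') (hT : IsForest (L ++ (H ++ R)))
    (hT' : IsForest (L ++ (H' ++ R))) (hT2 : IsForest (L' ++ (H ++ R')))
    (hT2' : IsForest (L' ++ (H' ++ R'))) {A : List (ℕ × ℕ)}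
    (hA : IsForestAlignment A (plug X L H R Y) (plug X' L H' R Y'))
    (hc1 : ∃ s ≤ L.length, ∀ i j, Aligns A i j → (i < X.length + s ↔ j < X'.length + s))
    (hc2 : ∃ s ≤ R.length, ∀ i j, Aligns A i j →
      (i < X.length + L.length + H.length + s ↔ j < X'.length + L.length + H'.length + s)) :
    ∃ A', IsForestAlignment A' (plug X L' H R' Y) (plug X' L' H' R' Y') ∧
      tedCost w (plug X L' H R' Y) (plug X' L' H' R' Y') A' ≤
        tedCost w (plug X L H R Y) (plug X' L H' R Y') A := by
  classical
  have hM : ∀ i j i' j', Aligns A i j → Aligns A i' j' → (i < i' ↔ j < j') :=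
    fun _ _ _ _ h h' => hA.isAlignment.aligns_lt_iff h h'
  set N := ReplacedMatching (Aligns A) X.length X'.length L.length H.length H'.length R.length
    L'.length R'.length with hNdef
  have hN : ∀ i j i' j', N i j → N i' j' → (i < i' ↔ j < j') :=
    replacedMatching_lt_iff hM hc1 hc2
  have hMfun : ∀ {i j j'}, Aligns A i j → Aligns A i j' → j = j' := by
    intro i j j' h1 h2
    have := hM _ _ _ _ h1 h2
    have := hM _ _ _ _ h2 h1
    omega
  obtain ⟨A', hA', hA'N⟩ := exists_alignment_of_monotone hN (plug X L' H R' Y).length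
    (plug X' L' H' R' Y').length
  set φ := movePos X.length L.length H.length R.length L'.length R'.length with hφ
  set ψ := movePos X'.length L.length H'.length R.length L'.length R'.length with hψ
  have hφnot : ∀ {i}, ¬ InHalves X.length L.length H.length R.length i →
      ¬ InHalves X.length L'.length H.length R'.length (φ i) := not_inHalves_movePos
  have hNmove : ∀ {i j}, ¬ InHalves X.length L.length H.length R.length i →
      ¬ InHalves X'.length L.length H'.length R.length j → (N (φ i) (ψ j) ↔ Aligns A i j) := by
    intro i j hi hj
    constructor
    · rintro (⟨p, q, h1, h2, h3, h4, h5⟩ | ⟨t, ht, h1, -⟩ | ⟨t, ht, h1, -⟩)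
      · rw [movePos_injective hi h2 h4, movePos_injective hj h3 h5]
        exact h1
      · exact absurd (Or.inl ⟨by omega, by omega⟩) (hφnot hi)
      · exact absurd (Or.inr ⟨by omega, by omega⟩) (hφnot hi)
    · intro h
      exact Or.inl ⟨i, j, h, hi, hj, rfl, rfl⟩
  have hNnat : ∀ {p q}, N p q → InHalves X.length L'.length H.length R'.length p ∨
      InHalves X'.length L'.length H'.length R'.length q →
      (∃ s < L'.length, p = X.length + s ∧ q = X'.length + s) ∨
      ∃ s < R'.length, p = X.length + L'.length + H.length + s ∧
        q = X'.length + L'.length + H'.length + s := by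
    rintro p q (⟨i, j, h1, h2, h3, rfl, rfl⟩ | h | h) h'
    · rcases h' with h' | h'
      · exact absurd h' (not_inHalves_movePos h2)
      · exact absurd h' (not_inHalves_movePos h3)
    · exact Or.inl h
    · exact Or.inr h
  have hφlt : ∀ {i}, i < (plug X L H R Y).length →
      ¬ InHalves X.length L.length H.length R.length i → φ i < (plug X L' H R' Y).length := by
    intro i hi h
    rw [length_plug] at *
    unfold InHalves at h
    rw [hφ]; unfold movePos
    split_ifs <;> omega
  have hψlt : ∀ {i}, i < (plug X' L H' R Y').length →
      ¬ InHalves X'.length L.length H'.length R.length i →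
      ψ i < (plug X' L' H' R' Y').length := by
    intro i hi h
    rw [length_plug] at *
    unfold InHalves at h
    rw [hψ]; unfold movePos
    split_ifs <;> omega
  refine ⟨A', ⟨hA', ?_⟩, ?_⟩
  · rintro ⟨o, c⟩ hu
    have hoc := hu.1
    have hcl := hu.2.1
    simp only at hoc hcl ⊢
    by_cases ho : InHalves X.length L'.length H.length R'.length o
    · right
      obtain ⟨o', c', hv, hnat⟩ := exists_node_plug_of_halves (X' := X') (Y' := Y') hH hH' hT2 hu ho
      have hN' : ∀ e e', (e = o ∧ e' = o') ∨ (e = c ∧ e' = c') → N e e' :=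
        fun e e' he => Or.inr (hnat e e' he)
      have hv1 := hv.1
      have hv2 := hv.2.1
      simp only at hv1 hv2
      exact ⟨(o', c'), hv, (hA'N _ _).2 ⟨hN' _ _ (Or.inl ⟨rfl, rfl⟩), by omega, by omega⟩,
        (hA'N _ _).2 ⟨hN' _ _ (Or.inr ⟨rfl, rfl⟩), by omega, by omega⟩⟩
    · have hc : ¬ InHalves X.length L'.length H.length R'.length c :=
        fun h => ho ((nodes_plug_halves_iff hH hT2 hu).2 h)
      obtain ⟨i, hi, hi1, rfl⟩ := exists_movePos_eq (a := L.length) (b := R.length)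
        (y := Y.length) ho (by rw [length_plug] at hcl; omega)
      obtain ⟨j, hj, hj1, rfl⟩ := exists_movePos_eq (a := L.length) (b := R.length)
        (y := Y.length) hc (by rw [length_plug] at hcl; omega)
      rw [← length_plug] at hi hj
      have hu' := (mem_nodes_plug_movePos_iff hH hT hT2 hi1 hj1 hj).1 hu
      -- An outside position that had no partner, or only one in the old halves, has no partner any
      -- more.
      have hdel : ∀ {e}, e < (plug X L H R Y).length →
          ¬ InHalves X.length L.length H.length R.length e →
          (∀ q, Aligns A e q → InHalves X'.length L.length H'.length R.length q) →
          Deletes A' (φ e) := by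
        intro e he he' hq
        refine (hA'.deletes_or_aligns (hφlt he he')).resolve_right ?_
        rintro ⟨q, hq'⟩
        rcases ((hA'N _ _).1 hq').1 with ⟨p, r, h1, h2, h3, h4, h5⟩ | ⟨t, ht, h1, -⟩ |
          ⟨t, ht, h1, -⟩
        · rw [← movePos_injective he' h2 h4] at h1
          exact h3 (hq _ h1)
        · exact absurd (Or.inl ⟨by omega, by omega⟩) (hφnot he')
        · exact absurd (Or.inr ⟨by omega, by omega⟩) (hφnot he')
      rcases hA.consistent _ hu' with ⟨h1, h2⟩ | ⟨⟨o', c'⟩, hv, h1, h2⟩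
      · left
        exact ⟨hdel hi hi1 fun q hq => absurd h1 (hA.isAlignment.not_deletes_of_aligns hq),
          hdel hj hj1 fun q hq => absurd h2 (hA.isAlignment.not_deletes_of_aligns hq)⟩
      · simp only at h1 h2
        -- The image node has both ends in the old halves or neither, so the two ends of the given
        -- node lose their partners together or not at all.
        by_cases ho' : InHalves X'.length L.length H'.length R.length o'
        · left
          have hc' := (nodes_plug_halves_iff hH' hT' hv).1 ho'
          exact ⟨hdel hi hi1 fun q hq => hMfun h1 hq ▸ ho',
            hdel hj hj1 fun q hq => hMfun h2 hq ▸ hc'⟩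
        · right
          have hc' : ¬ InHalves X'.length L.length H'.length R.length c' :=
            fun h => ho' ((nodes_plug_halves_iff hH' hT' hv).2 h)
          have hl1 := hA.isAlignment.aligns_lt h1
          have hl2 := hA.isAlignment.aligns_lt h2
          refine ⟨(ψ o', ψ c'), (mem_nodes_plug_movePos_iff hH' hT' hT2' ho' hc' hl2.2).2 hv,
            (hA'N _ _).2 ⟨(hNmove hi1 ho').2 h1, hφlt hi hi1, hψlt hl1.2 ho'⟩,
            (hA'N _ _).2 ⟨(hNmove hj1 hc').2 h2, hφlt hj hj1, hψlt hl2.2 hc'⟩⟩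
  · unfold tedCost
    refine ENNReal.div_le_div_right ?_ 2
    rw [hA'.edCost_eq, hA.isAlignment.edCost_eq]
    set I := Finset.range (plug X L H R Y).length
    set J := Finset.range (plug X' L H' R Y').length
    set I' := Finset.range (plug X L' H R' Y).length with hI'
    set J' := Finset.range (plug X' L' H' R' Y').length with hJ'
    set I₀ := (I \ Finset.Ico X.length (X.length + L.length)) \
      Finset.Ico (X.length + L.length + H.length) (X.length + L.length + H.length + R.length)
    set J₀ := (J \ Finset.Ico X'.length (X'.length + L.length)) \
      Finset.Ico (X'.length + L.length + H'.length) (X'.length + L.length + H'.length + R.length)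
    have hI₀ : ∀ {i}, i ∈ I₀ ↔ i < (plug X L H R Y).length ∧
        ¬ InHalves X.length L.length H.length R.length i := by
      intro i
      simp only [I₀, I, Finset.mem_sdiff, Finset.mem_range, Finset.mem_Ico, InHalves, not_or,
        and_assoc]
    have hJ₀ : ∀ {i}, i ∈ J₀ ↔ i < (plug X' L H' R Y').length ∧
        ¬ InHalves X'.length L.length H'.length R.length i := by
      intro i
      simp only [J₀, J, Finset.mem_sdiff, Finset.mem_range, Finset.mem_Ico, InHalves, not_or,
        and_assoc]
    have hI₀' : ∀ {p}, p ∈ I₀.image φ ↔ p ∈ I' ∧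
        ¬ InHalves X.length L'.length H.length R'.length p := by
      intro p
      simp only [Finset.mem_image, hI₀, I', Finset.mem_range]
      constructor
      · rintro ⟨i, ⟨h1, h2⟩, rfl⟩
        exact ⟨hφlt h1 h2, not_inHalves_movePos h2⟩
      · rintro ⟨h1, h2⟩
        rw [length_plug] at h1
        obtain ⟨i, hi, hi1, hi2⟩ := exists_movePos_eq (a := L.length) (b := R.length) h2 h1
        rw [← length_plug] at hi
        exact ⟨i, ⟨hi, hi1⟩, hi2⟩
    have hJ₀' : ∀ {p}, p ∈ J₀.image ψ ↔ p ∈ J' ∧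
        ¬ InHalves X'.length L'.length H'.length R'.length p := by
      intro p
      simp only [Finset.mem_image, hJ₀, J', Finset.mem_range]
      constructor
      · rintro ⟨i, ⟨h1, h2⟩, rfl⟩
        exact ⟨hψlt h1 h2, not_inHalves_movePos h2⟩
      · rintro ⟨h1, h2⟩
        rw [length_plug] at h1
        obtain ⟨i, hi, hi1, hi2⟩ := exists_movePos_eq (a := L.length) (b := R.length) h2 h1
        rw [← length_plug] at hi
        exact ⟨i, ⟨hi, hi1⟩, hi2⟩
    -- Read from the bottom up: the left and then the right half is excised, the remaining positions
    -- are renumbered, and the new halves come in at no cost.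
    calc matchCost (parenWeight w) (fun i => (plug X L' H R' Y)[i]?)
          (fun j => (plug X' L' H' R' Y')[j]?) (Aligns A') I' J'
        = matchCost (parenWeight w) (fun i => (plug X L' H R' Y)[i]?)
          (fun j => (plug X' L' H' R' Y')[j]?) N I' J' := by
          refine matchCost_congr (fun _ _ => rfl) (fun _ _ => rfl) fun i hi j hj => ?_
          rw [hA'N]
          simp only [I', J', Finset.mem_range] at hi hj
          exact ⟨fun h => h.1, fun h => ⟨h, hi, hj⟩⟩
      _ ≤ matchCost (parenWeight w) (fun i => (plug X L' H R' Y)[i]?)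
          (fun j => (plug X' L' H' R' Y')[j]?) N (I₀.image φ) (J₀.image ψ) := by
          refine matchCost_le_of_free (fun p hp => (hI₀'.1 hp).1) (fun p hp => (hJ₀'.1 hp).1)
            ?_ ?_ ?_
          · intro i hi hi'
            have hin : InHalves X.length L'.length H.length R'.length i := by
              by_contra h
              exact hi' (hI₀'.2 ⟨hi, h⟩)
            rcases hin with h | h
            · refine ⟨X'.length + (i - X.length), ?_, Or.inr (Or.inl ⟨i - X.length, by omega,
                by omega, rfl⟩)⟩
              simp only [J', Finset.mem_range, length_plug]; omega
            · refine ⟨X'.length + L'.length + H'.length + (i - X.length - L'.length - H.length),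
                ?_, Or.inr (Or.inr ⟨i - X.length - L'.length - H.length, by omega,
                by omega, rfl⟩)⟩
              simp only [J', Finset.mem_range, length_plug]; omega
          · intro i hi hi'
            have hin : InHalves X'.length L'.length H'.length R'.length i := by
              by_contra h
              exact hi' (hJ₀'.2 ⟨hi, h⟩)
            rcases hin with h | h
            · refine ⟨X.length + (i - X'.length), ?_, Or.inr (Or.inl ⟨i - X'.length, by omega,
                rfl, by omega⟩)⟩
              simp only [I', Finset.mem_range, length_plug]; omega
            · refine ⟨X.length + L'.length + H.length + (i - X'.length - L'.length - H'.length),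
                ?_, Or.inr (Or.inr ⟨i - X'.length - L'.length - H'.length, by omega,
                rfl, by omega⟩)⟩
              simp only [I', Finset.mem_range, length_plug]; omega
          · intro i hi j hj hij hor
            have hin : InHalves X.length L'.length H.length R'.length i ∨
                InHalves X'.length L'.length H'.length R'.length j := by
              by_contra h
              push Not at h
              rcases hor with h1 | h1
              · exact h1 (hI₀'.2 ⟨hi, h.1⟩)
              · exact h1 (hJ₀'.2 ⟨hj, h.2⟩)
            rcases hNnat hij hin with ⟨s, hs, rfl, rfl⟩ | ⟨s, hs, rfl, rfl⟩
            · rw [getElem?_plug_left _ _ _ _ _ hs, getElem?_plug_left _ _ _ _ _ hs]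
              exact hw.parenWeight_self _
            · rw [getElem?_plug_right _ _ _ _ _ hs, getElem?_plug_right _ _ _ _ _ hs]
              exact hw.parenWeight_self _
      _ = matchCost (parenWeight w) (fun i => (plug X L H R Y)[i]?)
          (fun j => (plug X' L H' R Y')[j]?) (Aligns A) I₀ J₀ := by
          rw [matchCost_map (fun i hi j hj h => movePos_injective (hI₀.1 hi).2 (hI₀.1 hj).2 h)
            (fun i hi j hj h => movePos_injective (hJ₀.1 hi).2 (hJ₀.1 hj).2 h)]
          exact matchCost_congr
            (fun i hi => getElem?_plug_movePos _ _ _ _ _ _ _ (hI₀.1 hi).2)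
            (fun i hi => getElem?_plug_movePos _ _ _ _ _ _ _ (hJ₀.1 hi).2)
            (fun i hi j hj => hNmove (hI₀.1 hi).2 (hJ₀.1 hj).2)
      _ ≤ matchCost (parenWeight w) (fun i => (plug X L H R Y)[i]?)
          (fun j => (plug X' L H' R Y')[j]?) (Aligns A)
          (I \ Finset.Ico X.length (X.length + L.length))
          (J \ Finset.Ico X'.length (X'.length + L.length)) := by
          obtain ⟨s, hs, hc2⟩ := hc2
          refine matchCost_sdiff_block hw.parenWeight_triangle hM hs hc2 ?_ ?_ ?_
          · intro i hi
            simp only [I, Finset.mem_sdiff, Finset.mem_Ico, Finset.mem_range, length_plug] at hi ⊢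
            omega
          · intro i hi
            simp only [J, Finset.mem_sdiff, Finset.mem_Ico, Finset.mem_range, length_plug] at hi ⊢
            omega
          · intro t ht
            rw [getElem?_plug_right _ _ _ _ _ ht, getElem?_plug_right _ _ _ _ _ ht]
      _ ≤ _ := by
          obtain ⟨s, hs, hc1⟩ := hc1
          refine matchCost_sdiff_block hw.parenWeight_triangle hM hs hc1 ?_ ?_ ?_
          · intro i hi
            simp only [I, Finset.mem_Ico, Finset.mem_range, length_plug] at hi ⊢
            omega
          · intro i hi
            simp only [J, Finset.mem_Ico, Finset.mem_range, length_plug] at hi ⊢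
            omega
          · intro t ht
            rw [getElem?_plug_left _ _ _ _ _ ht, getElem?_plug_left _ _ _ _ _ ht]

/-! ### The chain of nodes enclosing the hole, and vertical periodicity -/

section Spine

variable {α : Type*}

/-- The cut falls between top-level trees or strictly inside one of them, `L ++ R`. This is a single
step of the descent to the hole in `exists_spineChain`. -/
theorem IsForest.split {W : List (Paren α)} (hW : IsForest W) :
    ∀ X Y, W = X ++ Y → (IsForest X ∧ IsForest Y) ∨
      ∃ B L R B', IsForest B ∧ IsForest B' ∧ L ≠ [] ∧ R ≠ [] ∧ IsTree (L ++ R) ∧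
        X = B ++ L ∧ Y = R ++ B' := by
  induction hW with
  | nil =>
    intro X Y h
    obtain ⟨rfl, rfl⟩ := List.append_eq_nil_iff.mp h.symm
    exact Or.inl ⟨IsForest.nil, IsForest.nil⟩
  | @append F G hF hG ihF ihG =>
    intro X Y h
    rcases List.append_eq_append_iff.mp h with ⟨A, rfl, rfl⟩ | ⟨A, rfl, rfl⟩
    · rcases ihG A Y rfl with ⟨h1, h2⟩ | ⟨B, L, R, B', h1, h2, h3, h4, h5, rfl, rfl⟩
      · exact Or.inl ⟨hF.append h1, h2⟩
      · exact Or.inr ⟨F ++ B, L, R, B', hF.append h1, h2, h3, h4, h5, by simp, rfl⟩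
    · rcases ihF X A rfl with ⟨h1, h2⟩ | ⟨B, L, R, B', h1, h2, h3, h4, h5, rfl, rfl⟩
      · exact Or.inl ⟨h1, h2.append hG⟩
      · exact Or.inr ⟨B, L, R, B' ++ G, h1, h2.append hG, h3, h4, h5, rfl, by simp⟩
  | @wrap a F hF ih =>
    intro X Y h
    by_cases hX : X = []
    · subst hX
      refine Or.inl ⟨IsForest.nil, ?_⟩
      rw [List.nil_append] at h
      exact h ▸ IsForest.wrap a hF
    by_cases hY : Y = []
    · subst hY
      refine Or.inl ⟨?_, IsForest.nil⟩
      rw [List.append_nil] at h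
      exact h ▸ IsForest.wrap a hF
    exact Or.inr ⟨[], X, Y, [], IsForest.nil, IsForest.nil, hX, hY, h ▸ ⟨a, F, hF, rfl⟩, by simp,
      by simp⟩

/-- The nodes `0, …, m - 1` enclosing the hole of `⟨L; R⟩`, from the root inwards: the `l`-th one
has `o l` characters of `L` before it and `r l` characters of `R` after it. -/
structure SpineChain (L R : List (Paren α)) (m : ℕ) (o r : ℕ → ℕ) : Prop where
  o_zero : o 0 = 0
  r_zero : r 0 = 0
  o_last : o m = L.length
  r_last : r m = R.length
  o_lt : ∀ l < m, o l < o (l + 1)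
  r_lt : ∀ l < m, r l < r (l + 1)
  tree : ∀ l < m, IsTree (L.drop (o l) ++ R.take (R.length - r l))
  forest_left : ∀ l < m, IsForest (fragment L (o l + 1) (o (l + 1)))
  forest_right : ∀ l < m, IsForest (fragment R (R.length - r (l + 1)) (R.length - r l - 1))

theorem SpineChain.mono {L R : List (Paren α)} {m : ℕ} {o r : ℕ → ℕ} (h : SpineChain L R m o r)
    {l l' : ℕ} (hl : l ≤ l') (hm : l' ≤ m) : o l ≤ o l' ∧ r l ≤ r l' := by
  induction l', hl using Nat.le_induction with
  | base => exact ⟨le_rfl, le_rfl⟩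
  | succ l' hl ih =>
    have := h.o_lt l' (by omega)
    have := h.r_lt l' (by omega)
    have := ih (by omega)
    omega

/-- Descent towards the hole: the interior of the root is split there. Either the root is the
innermost enclosing node, or the top-level tree around the hole supplies the rest of the chain,
shifted past the root and the forests `B`, `B'`. -/
theorem exists_spineChain {L R : List (Paren α)} (hL : L ≠ []) (hR : R ≠ [])
    (h : IsTree (L ++ R)) : ∃ m o r, SpineChain L R m o r := by
  induction hn : L.length using Nat.strong_induction_on generalizing L R with
  | _ n ih =>
  have htree := h
  obtain ⟨p, L, rfl⟩ := List.exists_cons_of_ne_nil hL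
  rcases List.eq_nil_or_concat R with rfl | ⟨R, q, rfl⟩
  · exact absurd rfl hR
  simp only [List.concat_eq_append] at *
  rw [show p :: L ++ (R ++ [q]) = p :: ((L ++ R) ++ [q]) by simp, isTree_cons_concat_iff] at h
  rcases h.1.split L R rfl with ⟨h1, h2⟩ | ⟨B, L, R, B', h1, h2, h3, h4, h5, rfl, rfl⟩
  · refine ⟨1, fun l => l * (L.length + 1), fun l => l * (R.length + 1), by simp, by simp,
      by simp, by simp, ?_, ?_, ?_, ?_, ?_⟩
    all_goals
      intro l hl
      obtain rfl : l = 0 := by omega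
    · simp
    · simp
    · rw [zero_mul, zero_mul, Nat.sub_zero, List.take_length, List.drop_zero]
      exact htree
    · have : fragment (p :: L) (0 * (L.length + 1) + 1) ((0 + 1) * (L.length + 1)) = L := by
        simp [fragment]
      rwa [this]
    · have : fragment (R ++ [q]) ((R ++ [q]).length - (0 + 1) * (R.length + 1))
          ((R ++ [q]).length - 0 * (R.length + 1) - 1) = R := by
        simp [fragment]
      rwa [this]
  · obtain ⟨m, o, r, hc⟩ := ih L.length (by simp at hn; omega) h3 h4 h5 rfl
    have hmono : ∀ l ≤ m, o l ≤ L.length ∧ r l ≤ R.length := by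
      intro l hl
      have := hc.mono hl le_rfl
      rwa [hc.o_last, hc.r_last] at this
    have f1 : ∀ i j, j ≤ L.length → fragment (p :: (B ++ L)) (1 + B.length + i)
        (1 + B.length + j) = fragment L i j := by
      intro i j hj
      have := fragment_of_append (p :: B) L [] (o := i) hj
      simp only [List.append_nil, List.length_cons, List.cons_append] at this
      rw [← this]
      congr 1 <;> omega
    have f2 : ∀ i j, j ≤ R.length → fragment (R ++ B' ++ [q]) i j = fragment R i j := by
      intro i j hj
      have := fragment_of_append [] R (B' ++ [q]) (o := i) hj
      simpa using this
    have hlen : (R ++ B' ++ [q]).length = R.length + B'.length + 1 := by simp; omega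
    refine ⟨m + 1, fun l => if l = 0 then 0 else 1 + B.length + o (l - 1),
      fun l => if l = 0 then 0 else 1 + B'.length + r (l - 1), rfl, rfl, ?_, ?_, ?_, ?_, ?_, ?_, ?_⟩
    · simp [hc.o_last]; omega
    · simp [hc.r_last]; omega
    · rintro (_ | l) hl
      · simp
      · have := hc.o_lt l (by omega)
        simp; omega
    · rintro (_ | l) hl
      · simp
      · have := hc.r_lt l (by omega)
        simp; omega
    · rintro (_ | l) hl
      · simp only [if_true, Nat.sub_zero, List.take_length, List.drop_zero]
        exact htree
      · have h6 := hc.tree l (by omega)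
        have h7 := hmono l (by omega)
        simp only [Nat.add_eq_zero_iff, one_ne_zero, and_false, if_false, Nat.add_sub_cancel]
        rw [← fragment_zero, f2 _ _ (by rw [hlen]; omega), ← fragment_length]
        have e1 : (p :: (B ++ L)).length = 1 + B.length + L.length := by simp; omega
        rw [e1, f1 _ _ le_rfl, fragment_length, fragment_zero, hlen]
        rwa [show R.length + B'.length + 1 - (1 + B'.length + r l) = R.length - r l by omega]
    · rintro (_ | l) hl
      · have : fragment (p :: (B ++ L)) 1 (1 + B.length + 0) = B := by simp [fragment, add_comm 1]
        simp only [zero_add, one_ne_zero, if_false, if_true, Nat.sub_self, hc.o_zero]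
        rw [this]
        exact h1
      · have h6 := hc.forest_left l (by omega)
        have h7 := hmono (l + 1) (by omega)
        simp only [Nat.add_eq_zero_iff, one_ne_zero, and_false, if_false, Nat.add_sub_cancel]
        rw [add_assoc (1 + B.length), f1 _ _ (by omega)]
        exact h6
    · rintro (_ | l) hl
      · have : fragment (R ++ B' ++ [q]) R.length (R.length + B'.length) = B' := by
          simp [fragment, List.take_append]
        simp only [zero_add, one_ne_zero, if_false, if_true, hlen, Nat.sub_self, hc.r_zero]
        rw [show R.length + B'.length + 1 - (1 + B'.length + 0) = R.length by omega,
          show R.length + B'.length + 1 - 0 - 1 = R.length + B'.length by omega, this]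
        exact h2
      · have h6 := hc.forest_right l (by omega)
        have h7 := hmono (l + 1) (by omega)
        have h8 := hc.r_lt l (by omega)
        simp only [Nat.add_eq_zero_iff, one_ne_zero, and_false, if_false, Nat.add_sub_cancel, hlen]
        rw [show R.length + B'.length + 1 - (1 + B'.length + r (l + 1)) =
            R.length - r (l + 1) by omega,
          show R.length + B'.length + 1 - (1 + B'.length + r l) - 1 = R.length - r l - 1 by omega,
          f2 _ _ (by omega)]
        exact h6

/-- A long sequence with few bad steps contains a long stretch without bad steps. -/
theorem le_of_good_stretches {t : ℕ → ℕ} {Z W : ℕ} (q : ℕ) (Bad : Finset ℕ) (m : ℕ)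
    (hZ : ∀ l < m, t (l + 1) ≤ t l + Z)
    (hW : ∀ a b, a < b → b ≤ m → (∀ l, a ≤ l → l < b → l ∉ Bad) → t b ≤ t a + W)
    (hq : (Bad.filter (· < m)).card ≤ q) : t m ≤ t 0 + q * Z + (q + 1) * W := by
  induction q generalizing m with
  | zero =>
    rcases Nat.eq_zero_or_pos m with rfl | hm
    · omega
    · have := hW 0 m hm le_rfl fun l _ hl hb => by
        have : l ∈ Bad.filter (· < m) := Finset.mem_filter.2 ⟨hb, hl⟩
        rw [Finset.card_eq_zero.1 (Nat.le_zero.1 hq)] at this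
        simp at this
      omega
  | succ q ih =>
    by_cases hne : (Bad.filter (· < m)).Nonempty
    -- Split at the last bad step: a good stretch follows it, the step itself adds at most `Z`, and
    -- fewer bad steps precede it.
    · set l := (Bad.filter (· < m)).max' hne
      have hl : l ∈ Bad.filter (· < m) := Finset.max'_mem _ hne
      obtain ⟨hlB, hlm⟩ := Finset.mem_filter.1 hl
      have h1 : t m ≤ t (l + 1) + W := by
        rcases Nat.eq_or_lt_of_le (show l + 1 ≤ m from hlm) with h2 | h2
        · rw [← h2]; omega
        · refine hW _ _ h2 le_rfl fun l' h3 h4 h5 => ?_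
          have := Finset.le_max' (Bad.filter (· < m)) l' (Finset.mem_filter.2 ⟨h5, h4⟩)
          omega
      have h2 := hZ l hlm
      have h3 := ih l (fun l' hl' => hZ l' (by omega))
        (fun a b hab hb => hW a b hab (by omega)) (by
          have : (Bad.filter (· < l)) ⊂ Bad.filter (· < m) := by
            rw [Finset.ssubset_iff_of_subset]
            · exact ⟨l, hl, by simp⟩
            · intro x hx
              simp only [Finset.mem_filter] at hx ⊢
              exact ⟨hx.1, by omega⟩
          have := Finset.card_lt_card this
          omega)
      have h4 : (q + 1) * Z = q * Z + Z := by ring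
      have h5 : (q + 1 + 1) * W = (q + 1) * W + W := by ring
      omega
    · rw [Finset.not_nonempty_iff_eq_empty] at hne
      have := ih m hZ hW (by rw [hne]; simp)
      have h4 : (q + 1) * Z = q * Z + Z := by ring
      have h5 : (q + 1 + 1) * W = (q + 1) * W + W := by ring
      omega

/-- The inner tree is a forest inside the outer tree, and erasing it leaves a tree. -/
theorem isTree_between {L R : List (Paren α)} {i r i' r' : ℕ} (hi : i < i') (hr : r < r')
    (hi' : i' < L.length) (hr' : r' < R.length)
    (h : IsTree (L.drop i ++ R.take (R.length - r)))
    (h' : IsTree (L.drop i' ++ R.take (R.length - r'))) :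
    IsTree (fragment L i i' ++ fragment R (R.length - r') (R.length - r)) := by
  have e1 := fragment_append_fragment L hi.le hi'.le le_rfl
  have e2 := fragment_append_fragment R (Nat.zero_le (R.length - r'))
    (show R.length - r' ≤ R.length - r by omega) (by omega)
  simp only [fragment_length, fragment_zero] at e1 e2
  rw [← e1, ← e2] at h
  rw [← isTree_insert_iff h'.isForest (fragment_ne_nil hi hi'.le)
    (fragment_ne_nil (by omega) (by omega))]
  simpa using h

theorem fragment_shift {β : Type*} {X : List β} {i j d : ℕ}
    (h : ∀ x, i ≤ x → x < j → X[x]? = X[x + d]?) :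
    fragment X (i + d) (j + d) = fragment X i j := by
  apply List.ext_getElem?
  intro t
  simp only [getElem?_fragment]
  by_cases ht : i + t < j
  · rw [if_pos ht, if_pos (by omega), h _ (by omega) ht]
    congr 1; omega
  · rw [if_neg ht, if_neg (by omega)]

/-- A context with equally spaced enclosing nodes and periodic halves is vertically periodic. -/
theorem Context.exists_eq_comp_powSucc (P : Context α) {i r d e n : ℕ} (hd : 0 < d) (he : 0 < e)
    (hi0 : 0 < i) (hr0 : 0 < r)
    (hi : i + (n + 1) * d < P.left.length) (hr : r + (n + 1) * e < P.right.length)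
    (htree : ∀ s ≤ n + 1, IsTree (P.left.drop (i + s * d) ++
      P.right.take (P.right.length - (r + s * e))))
    (hleft : ∀ x, i ≤ x → x + d < i + (n + 1) * d → P.left[x]? = P.left[x + d]?)
    (hright : ∀ x, r ≤ x → x + e < r + (n + 1) * e →
      P.right[P.right.length - 1 - x]? = P.right[P.right.length - 1 - (x + e)]?) :
    ∃ C Q D : Context α, Q.size = d + e ∧ P = (C.comp (Q.powSucc n)).comp D := by
  have hdn : ∀ s ≤ n, i + (s + 1) * d ≤ i + (n + 1) * d := fun s hs => by gcongr
  have hen : ∀ s ≤ n, r + (s + 1) * e ≤ r + (n + 1) * e := fun s hs => by gcongr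
  have h0 : IsTree (P.left.drop 0 ++ P.right.take (P.right.length - 0)) := by
    simpa using P.isTree
  have h1 := htree 0 (by omega)
  have h2 := htree 1 (by omega)
  have h3 := htree (n + 1) le_rfl
  have hd1 := hdn 0 (by omega)
  have he1 := hen 0 (by omega)
  simp only [zero_mul, add_zero, one_mul, zero_add] at h1 h2 hd1 he1
  let C : Context α := ⟨fragment P.left 0 i,
    fragment P.right (P.right.length - r) (P.right.length - 0),
    fragment_ne_nil hi0 (by omega), fragment_ne_nil (by omega) (by omega),
    isTree_between hi0 hr0 (by omega) (by omega) h0 h1⟩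
  let Q : Context α := ⟨fragment P.left i (i + d),
    fragment P.right (P.right.length - (r + e)) (P.right.length - r),
    fragment_ne_nil (by omega) (by omega), fragment_ne_nil (by omega) (by omega),
    isTree_between (by omega) (by omega) (by omega) (by omega) h1 h2⟩
  let D : Context α := ⟨P.left.drop (i + (n + 1) * d),
    P.right.take (P.right.length - (r + (n + 1) * e)),
    by rw [← List.length_pos_iff, List.length_drop]; omega,
    by rw [← List.length_pos_iff, List.length_take]; omega, h3⟩
  -- Each further copy of `Q` is added on the outside; by periodicity the stack built so far equals
  -- its translate one period further inwards.
  have hpow : ∀ s ≤ n, (Q.powSucc s).left = fragment P.left i (i + (s + 1) * d) ∧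
      (Q.powSucc s).right = fragment P.right (P.right.length - (r + (s + 1) * e))
        (P.right.length - r) := by
    intro s
    induction s with
    | zero => intro _; simp [Context.powSucc, Q]
    | succ s ih =>
      intro hs
      obtain ⟨ih1, ih2⟩ := ih (by omega)
      have k1 := hdn (s + 1) hs
      have k2 := hen (s + 1) hs
      have e1 : (s + 1 + 1) * d = (s + 1) * d + d := by ring
      have e2 : (s + 1 + 1) * e = (s + 1) * e + e := by ring
      have e3 : (s + 1) * d = s * d + d := by ring
      have e4 : (s + 1) * e = s * e + e := by ring
      constructor
      · show Q.left ++ (Q.powSucc s).left = _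
        rw [ih1, ← fragment_shift (X := P.left) (d := d) (i := i) (fun x hx1 hx2 =>
          hleft x hx1 (by omega))]
        show fragment P.left i (i + d) ++ _ = _
        rw [fragment_append_fragment _ (by omega) (by omega) (by omega), e1, add_assoc]
      · show (Q.powSucc s).right ++ Q.right = _
        -- `hright` counts positions from the right end, so it is applied to the reflected position.
        have key := fragment_shift (X := P.right) (d := e)
          (i := P.right.length - (r + (s + 1 + 1) * e)) (j := P.right.length - (r + e))
          (fun x hx1 hx2 => by
            have := hright (P.right.length - 1 - (x + e)) (by omega) (by omega)
            rw [show P.right.length - 1 - (P.right.length - 1 - (x + e)) = x + e by omega,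
              show P.right.length - 1 - (P.right.length - 1 - (x + e) + e) = x by omega] at this
            exact this.symm)
        rw [show P.right.length - (r + (s + 1 + 1) * e) + e =
            P.right.length - (r + (s + 1) * e) by omega,
          show P.right.length - (r + e) + e = P.right.length - r by omega] at key
        rw [ih2, key]
        show _ ++ fragment P.right (P.right.length - (r + e)) (P.right.length - r) = _
        rw [fragment_append_fragment _ (by omega) (by omega) (by omega)]
  refine ⟨C, Q, D, ?_, ?_⟩
  · show (fragment P.left i (i + d)).length +
      (fragment P.right (P.right.length - (r + e)) (P.right.length - r)).length = d + e
    rw [length_fragment, length_fragment]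
    omega
  · obtain ⟨hp1, hp2⟩ := hpow n le_rfl
    ext1
    · show P.left = (fragment P.left 0 i ++ (Q.powSucc n).left) ++ P.left.drop (i + (n + 1) * d)
      rw [hp1, fragment_append_fragment _ (by omega) (by omega) (by omega), fragment_zero,
        List.take_append_drop]
    · show P.right = P.right.take (P.right.length - (r + (n + 1) * e)) ++
        ((Q.powSucc n).right ++ fragment P.right (P.right.length - r) (P.right.length - 0))
      rw [hp2, fragment_append_fragment _ (by omega) (by omega) (by omega), Nat.sub_zero,
        fragment_length, List.take_append_drop]

end Spine

/-! ### Enclosing nodes as cuts of both halves -/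

section SpineCut

variable {α : Type*}

/-- There is a node around the hole of `⟨L; R⟩` with `i` characters of `L` before it and `r`
characters of `R` after it. -/
def SpineCut (L R : List (Paren α)) (i r : ℕ) : Prop :=
  i < L.length ∧ r < R.length ∧ IsTree (L.drop i ++ R.take (R.length - r))

theorem mem_nodes_plug_iff_spineCut {X L H R Y : List (Paren α)} (hH : IsForest H) {i r : ℕ}
    (hi : i < L.length) (hr : r < R.length) :
    (X.length + i, X.length + L.length + H.length + R.length - 1 - r) ∈ nodes (plug X L H R Y) ↔
      SpineCut L R i r := by
  rw [show X.length + L.length + H.length + R.length - 1 - r =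
      X.length + L.length + H.length + (R.length - 1 - r) by omega,
    mem_nodes_plug_spine_iff hH hi (by omega), show R.length - 1 - r + 1 = R.length - r by omega]
  exact ⟨fun h => ⟨hi, hr, h⟩, fun h => h.2.2⟩

/-- Nodes around the same hole are nested, and distinct ones share neither end. -/
theorem SpineCut.lt_iff {L R : List (Paren α)} {i r i' r' : ℕ} (h : SpineCut L R i r)
    (h' : SpineCut L R i' r') : i < i' ↔ r < r' := by
  have k := (mem_nodes_plug_iff_spineCut (X := []) (Y := []) IsForest.nil h.1 h.2.1).2 h
  have k' := (mem_nodes_plug_iff_spineCut (X := []) (Y := []) IsForest.nil h'.1 h'.2.1).2 h'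
  have h1 := h.1
  have h2 := h.2.1
  have h1' := h'.1
  have h2' := h'.2.1
  simp only [List.length_nil, zero_add, add_zero] at k k'
  constructor
  · intro hlt
    have := nodes_nest_lt k k' hlt (by omega)
    omega
  · intro hlt
    rcases lt_trichotomy i i' with h3 | h3 | h3
    · exact h3
    · subst h3
      have := nodes_closing_unique k k'
      omega
    · have := nodes_nest_lt k' k h3 (by omega)
      omega

/-- Otherwise the node would contain the opening parenthesis of an enclosing node without its
closing one, which lies in `R`. -/
theorem SpineCut.left_node_lt {L R : List (Paren α)} {i1 r1 i c : ℕ} (h : SpineCut L R i1 r1)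
    (hn : (i, c) ∈ nodes L) (hi : i < i1) : c < i1 := by
  have h1 := h.1
  have h2 := h.2.1
  have hc := hn.2.1
  simp only at hc
  have k := (mem_nodes_plug_iff_spineCut (X := []) (Y := []) IsForest.nil h1 h2).2 h
  have k' := (mem_nodes_plug_left_iff (X := []) (H := []) (R := R) (Y := []) hc).2 hn
  simp only [List.length_nil, zero_add, add_zero] at k k'
  by_contra hlt
  have := nodes_nest_lt k' k hi (by omega)
  omega

theorem SpineCut.right_node_lt {L R : List (Paren α)} {i1 r1 r ρ : ℕ} (h : SpineCut L R i1 r1)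
    (hρ : ρ < R.length) (hn : (R.length - 1 - ρ, R.length - 1 - r) ∈ nodes R) (hr : r < r1) :
    ρ < r1 := by
  have h1 := h.1
  have h2 := h.2.1
  have hc := hn.2.1
  simp only at hc
  have k := (mem_nodes_plug_iff_spineCut (X := []) (Y := []) IsForest.nil h1 h2).2 h
  have k' := (mem_nodes_plug_right_iff (X := []) (L := L) (H := []) (Y := []) hc).2 hn
  simp only [List.length_nil, zero_add, add_zero] at k k'
  by_contra hlt
  have h3 := nodes_nest k k' (by omega)
  by_cases h4 : ρ = r1
  · subst h4
    obtain ⟨a, -, ha⟩ := nodes_letters k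
    obtain ⟨a', ha', -⟩ := nodes_letters k'
    rw [show L.length + R.length - 1 - ρ = L.length + (R.length - 1 - ρ) by omega] at ha
    rw [ha] at ha'
    simp at ha'
  · have := h3 (by omega)
    omega

theorem node_plug_cases_left {X L H R Y : List (Paren α)} (hH : IsForest H)
    (hT : IsForest (L ++ (H ++ R))) {i c : ℕ} (hi : i < L.length)
    (h : (X.length + i, c) ∈ nodes (plug X L H R Y)) :
    (∃ j < L.length, c = X.length + j ∧ (i, j) ∈ nodes L) ∨
      ∃ r < R.length, c = X.length + L.length + H.length + R.length - 1 - r ∧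
        SpineCut L R i r := by
  have hc := (nodes_plug_halves_iff hH hT h).1 (Or.inl ⟨by omega, by omega⟩)
  rcases hc with hc | hc
  · obtain ⟨j, rfl⟩ := Nat.exists_eq_add_of_le hc.1
    exact Or.inl ⟨j, by omega, rfl, (mem_nodes_plug_left_iff (by omega)).1 h⟩
  · have e : c = X.length + L.length + H.length + R.length - 1 -
        (X.length + L.length + H.length + R.length - 1 - c) := by omega
    rw [e] at h
    exact Or.inr ⟨_, by omega, e, (mem_nodes_plug_iff_spineCut hH hi (by omega)).1 h⟩

theorem node_plug_cases_right {X L H R Y : List (Paren α)} (hH : IsForest H)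
    (hT : IsForest (L ++ (H ++ R))) {r o : ℕ} (hr : r < R.length)
    (h : (o, X.length + L.length + H.length + R.length - 1 - r) ∈ nodes (plug X L H R Y)) :
    (∃ ρ < R.length, o = X.length + L.length + H.length + R.length - 1 - ρ ∧
      (R.length - 1 - ρ, R.length - 1 - r) ∈ nodes R) ∨
      ∃ i < L.length, o = X.length + i ∧ SpineCut L R i r := by
  have hc := (nodes_plug_halves_iff hH hT h).2 (Or.inr ⟨by omega, by omega⟩)
  rcases hc with hc | hc
  · obtain ⟨i, rfl⟩ := Nat.exists_eq_add_of_le hc.1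
    exact Or.inr ⟨i, by omega, rfl, (mem_nodes_plug_iff_spineCut hH (by omega) hr).1 h⟩
  · obtain ⟨j, rfl⟩ := Nat.exists_eq_add_of_le hc.1
    refine Or.inl ⟨R.length - 1 - j, by omega, by omega, ?_⟩
    rw [show X.length + L.length + H.length + R.length - 1 - r =
      X.length + L.length + H.length + (R.length - 1 - r) by omega,
      mem_nodes_plug_right_iff (by omega)] at h
    rwa [show R.length - 1 - (R.length - 1 - j) = j by omega]

end SpineCut

/-! ### Matchings that shift a stretch of the context -/

section Matching

variable {α : Type*}

/-- A strictly monotone matching of positions that matches nodes with nodes. -/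
structure IsNodeMatching (F G : List (Paren α)) (M : ℕ → ℕ → Prop) : Prop where
  lt_iff : ∀ i j i' j', M i j → M i' j' → (i < i' ↔ j < j')
  opening_node : ∀ x y c, M x y → (x, c) ∈ nodes F → ∃ d, (y, d) ∈ nodes G ∧ M c d
  closing_node : ∀ x y o, M x y → (o, x) ∈ nodes F → ∃ d, (d, y) ∈ nodes G ∧ M o d
  exists_node : ∀ x y, M x y → ∃ o c, (o, c) ∈ nodes F ∧ (o = x ∨ c = x)

theorem IsForestAlignment.isNodeMatching {F G : List (Paren α)} {A : List (ℕ × ℕ)}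
    (hF : IsForest F) (hA : IsForestAlignment A F G) : IsNodeMatching F G (Aligns A) := by
  have hM : ∀ i j i' j', Aligns A i j → Aligns A i' j' → (i < i' ↔ j < j') :=
    fun _ _ _ _ h h' => hA.isAlignment.aligns_lt_iff h h'
  have hMfun : ∀ {i j j'}, Aligns A i j → Aligns A i j' → j = j' := by
    intro i j j' h1 h2
    have := hM _ _ _ _ h1 h2
    have := hM _ _ _ _ h2 h1
    omega
  refine ⟨hM, ?_, ?_, fun x y h => hF.exists_node (hA.isAlignment.aligns_lt h).1⟩
  · intro x y c h hu
    rcases hA.consistent _ hu with ⟨h1, -⟩ | ⟨v, hv, h1, h2⟩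
    · exact absurd h1 (hA.isAlignment.not_deletes_of_aligns h)
    · exact ⟨v.2, hMfun h1 h ▸ hv, h2⟩
  · intro x y c h hu
    rcases hA.consistent _ hu with ⟨-, h1⟩ | ⟨v, hv, h1, h2⟩
    · exact absurd h1 (hA.isAlignment.not_deletes_of_aligns h)
    · exact ⟨v.1, hMfun h2 h ▸ hv, h1⟩

namespace IsNodeMatching

variable {F G : List (Paren α)} {M : ℕ → ℕ → Prop}

theorem snd_eq (h : IsNodeMatching F G M) {i j j' : ℕ} (h1 : M i j) (h2 : M i j') : j = j' := by
  have := h.lt_iff _ _ _ _ h1 h2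
  have := h.lt_iff _ _ _ _ h2 h1
  omega

/-- A matched closing parenthesis has a closing image, so the preimage of an opening parenthesis
opens a node; the image of that node is the given one. -/
theorem exists_opening_node (h : IsNodeMatching F G M) {x y d : ℕ} (hxy : M x y)
    (hd : (y, d) ∈ nodes G) : ∃ c, (x, c) ∈ nodes F ∧ M c d := by
  obtain ⟨o, c, hu, rfl | rfl⟩ := h.exists_node x y hxy
  · obtain ⟨d', hd', hc⟩ := h.opening_node _ _ _ hxy hu
    exact ⟨c, hu, nodes_closing_unique hd hd' ▸ hc⟩
  · obtain ⟨d', hd', hc⟩ := h.closing_node _ _ _ hxy hu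
    obtain ⟨a, ha, -⟩ := nodes_letters hd
    obtain ⟨a', -, ha'⟩ := nodes_letters hd'
    rw [ha] at ha'
    simp at ha'

theorem exists_closing_node (h : IsNodeMatching F G M) {x y d : ℕ} (hxy : M x y)
    (hd : (d, y) ∈ nodes G) : ∃ o, (o, x) ∈ nodes F ∧ M o d := by
  obtain ⟨o, c, hu, rfl | rfl⟩ := h.exists_node x y hxy
  · obtain ⟨d', hd', hc⟩ := h.opening_node _ _ _ hxy hu
    obtain ⟨a, -, ha⟩ := nodes_letters hd
    obtain ⟨a', ha', -⟩ := nodes_letters hd'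
    rw [ha] at ha'
    simp at ha'
  · obtain ⟨d', hd', hc⟩ := h.closing_node _ _ _ hxy hu
    exact ⟨o, hu, nodes_opening_unique hd hd' ▸ hc⟩

/-- Matched positions are both opening or both closing, since nodes go to nodes; the label then
determines the letter. -/
theorem letter_eq (h : IsNodeMatching F G M) {x y : ℕ} (hxy : M x y)
    (hlab : F[x]?.map Paren.label = G[y]?.map Paren.label) : F[x]? = G[y]? := by
  obtain ⟨o, c, hu, rfl | rfl⟩ := h.exists_node x y hxy
  · obtain ⟨d', hd', -⟩ := h.opening_node _ _ _ hxy hu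
    obtain ⟨a, ha, -⟩ := nodes_letters hu
    obtain ⟨a', ha', -⟩ := nodes_letters hd'
    rw [ha, ha'] at hlab ⊢
    simpa [Paren.label] using hlab
  · obtain ⟨d', hd', -⟩ := h.closing_node _ _ _ hxy hu
    obtain ⟨a, -, ha⟩ := nodes_letters hu
    obtain ⟨a', -, ha'⟩ := nodes_letters hd'
    rw [ha, ha'] at hlab ⊢
    simpa [Paren.label] using hlab

end IsNodeMatching

/-- A stretch of the halves `L`, `R`, from an enclosing node `(i₀, r₀)` to a deeper one `(i₁, r₁)`
or to the hole. -/
structure IsStretch (L R : List (Paren α)) (i₀ i₁ r₀ r₁ : ℕ) : Prop where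
  lt_left : i₀ < i₁
  lt_right : r₀ < r₁
  start : SpineCut L R i₀ r₀
  finish : (i₁ = L.length ∧ r₁ = R.length) ∨ SpineCut L R i₁ r₁

namespace IsStretch

variable {L R : List (Paren α)} {i₀ i₁ r₀ r₁ : ℕ}

theorem le_length (h : IsStretch L R i₀ i₁ r₀ r₁) : i₁ ≤ L.length ∧ r₁ ≤ R.length := by
  rcases h.finish with h1 | h1
  · omega
  · exact ⟨h1.1.le, h1.2.1.le⟩

theorem lt_iff (h : IsStretch L R i₀ i₁ r₀ r₁) {i r : ℕ} (hs : SpineCut L R i r) :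
    i < i₁ ↔ r < r₁ := by
  rcases h.finish with h1 | h1
  · have := hs.1
    have := hs.2.1
    omega
  · exact hs.lt_iff h1

theorem left_node_lt (h : IsStretch L R i₀ i₁ r₀ r₁) {i c : ℕ} (hn : (i, c) ∈ nodes L)
    (hi : i < i₁) : c < i₁ := by
  rcases h.finish with h1 | h1
  · rw [h1.1]; exact hn.2.1
  · exact h1.left_node_lt hn hi

theorem right_node_lt (h : IsStretch L R i₀ i₁ r₀ r₁) {r ρ : ℕ} (hρ : ρ < R.length)
    (hn : (R.length - 1 - ρ, R.length - 1 - r) ∈ nodes R) (hr : r < r₁) : ρ < r₁ := by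
  rcases h.finish with h1 | h1
  · rw [h1.2]; exact hρ
  · exact h1.right_node_lt hρ hn hr

variable {X H Y X' H' Y' : List (Paren α)} {M : ℕ → ℕ → Prop}

/-- A matching that shifts a stretch of a context inwards maps the enclosing nodes to enclosing
nodes. -/
theorem spineCut_inward (h : IsStretch L R i₀ i₁ r₀ r₁)
    (hM : IsNodeMatching (plug X L H R Y) (plug X' L H' R Y') M)
    (hH : IsForest H) (hH' : IsForest H') (hT' : IsForest (L ++ (H' ++ R))) {d e : ℕ}
    (hd : 0 < d) (he : 0 < e)
    (hML : ∀ i, i₀ ≤ i → i < i₁ → M (X.length + i) (X'.length + i + d))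
    (hMR : ∀ r, r₀ ≤ r → r < r₁ → r + e < X'.length + L.length + H'.length + R.length ∧
      M (X.length + L.length + H.length + R.length - 1 - r)
        (X'.length + L.length + H'.length + R.length - 1 - r - e))
    {i r : ℕ} (hs : SpineCut L R i r) (hi : i₀ ≤ i) (hi' : i < i₁) (hr : r₀ ≤ r) (hr' : r < r₁)
    (hrem : i + d < i₁ ∨ r + e < r₁) : SpineCut L R (i + d) (r + e) := by
  obtain ⟨hl1, hl2⟩ := h.le_length
  have hu := (mem_nodes_plug_iff_spineCut (X := X) (Y := Y) hH hs.1 hs.2.1).2 hs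
  have m1 := hML i hi hi'
  obtain ⟨hb, m2⟩ := hMR r hr hr'
  obtain ⟨c', hv, m3⟩ := hM.opening_node _ _ _ m1 hu
  rw [← hM.snd_eq m2 m3] at hv
  -- It is enough that one end of the image node stays in the stretch: the partner of that end then
  -- has to lie in the opposite half.
  rcases hrem with hrem | hrem
  · rw [add_assoc] at hv
    rcases node_plug_cases_left hH' hT' (by omega) hv with ⟨j, hj, e1, hn⟩ | ⟨ρ, hρ, e1, hsc⟩
    -- If the image node closed at a position `j` of `L`, then `j`, which precedes the closing
    -- parenthesis in `R`, would be sent to `j + d`, beyond the image `j` of that parenthesis.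
    · exfalso
      have hjlt := h.left_node_lt hn hrem
      have hjn := hn.1
      simp only at hjn
      have m4 := hML j (by omega) hjlt
      have := hM.lt_iff _ _ _ _ m4 m2
      omega
    · have : ρ = r + e := by omega
      exact this ▸ hsc
  · rw [show X'.length + L.length + H'.length + R.length - 1 - r - e =
      X'.length + L.length + H'.length + R.length - 1 - (r + e) by omega] at hv
    rcases node_plug_cases_right hH' hT' (by omega) hv with ⟨ρ, hρ, e1, hn⟩ | ⟨j, hj, e1, hsc⟩
    · exfalso
      have hρlt := h.right_node_lt hρ hn hrem
      have hρn := hn.1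
      simp only at hρn
      obtain ⟨-, m4⟩ := hMR ρ (by omega) hρlt
      have := hM.lt_iff _ _ _ _ m1 m4
      omega
    · have : j = i + d := by omega
      exact this ▸ hsc

/-- A matching that shifts a stretch of a context outwards maps enclosing nodes to the enclosing
nodes. -/
theorem spineCut_outward (h : IsStretch L R i₀ i₁ r₀ r₁)
    (hM : IsNodeMatching (plug X L H R Y) (plug X' L H' R Y') M)
    (hH : IsForest H) (hH' : IsForest H') (hT : IsForest (L ++ (H ++ R))) {d e : ℕ}
    (hd : 0 < d) (he : 0 < e)
    (hML : ∀ i, i₀ ≤ i → i < i₁ → d ≤ X'.length + i ∧ M (X.length + i) (X'.length + i - d))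
    (hMR : ∀ r, r₀ ≤ r → r < r₁ → M (X.length + L.length + H.length + R.length - 1 - r)
        (X'.length + L.length + H'.length + R.length - 1 - r + e))
    {i r : ℕ} (hs : SpineCut L R i r) (hi : i₀ ≤ i) (hi' : i < i₁) (hr : r₀ ≤ r) (hr' : r < r₁)
    (hrem : i + d < i₁ ∨ r + e < r₁) : SpineCut L R (i + d) (r + e) := by
  obtain ⟨hl1, hl2⟩ := h.le_length
  -- An outward shift is used backwards: the node is placed in the second forest and its preimage is
  -- located.
  have hu := (mem_nodes_plug_iff_spineCut (X := X') (Y := Y') hH' hs.1 hs.2.1).2 hs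
  rcases hrem with hrem | hrem
  · have m1 := (hML (i + d) (by omega) hrem).2
    rw [show X'.length + (i + d) - d = X'.length + i by omega] at m1
    obtain ⟨c, hv, m2⟩ := hM.exists_opening_node m1 hu
    rcases node_plug_cases_left hH hT (by omega) hv with ⟨j, hj, rfl, hn⟩ | ⟨ρ, hρ, rfl, hsc⟩
    · exfalso
      have hjlt := h.left_node_lt hn hrem
      have hjn := hn.1
      simp only at hjn
      have m4 := (hML j (by omega) hjlt).2
      have := hM.snd_eq m2 m4
      omega
    · have h1 := (h.lt_iff hsc).1 hrem
      have h2 := (h.start.lt_iff hsc).1 (by omega)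
      have := hM.snd_eq m2 (hMR ρ (by omega) h1)
      have : ρ = r + e := by omega
      exact this ▸ hsc
  · have m1 := hMR (r + e) (by omega) hrem
    rw [show X'.length + L.length + H'.length + R.length - 1 - (r + e) + e =
      X'.length + L.length + H'.length + R.length - 1 - r by omega] at m1
    obtain ⟨o, hv, m2⟩ := hM.exists_closing_node m1 hu
    rcases node_plug_cases_right hH hT (by omega) hv with ⟨ρ, hρ, rfl, hn⟩ | ⟨j, hj, rfl, hsc⟩
    · exfalso
      have hρlt := h.right_node_lt hρ hn hrem
      have hρn := hn.1
      simp only at hρn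
      have := hM.snd_eq m2 (hMR ρ (by omega) hρlt)
      omega
    · have h1 := (h.lt_iff hsc).2 hrem
      have h2 := (h.start.lt_iff hsc).2 (by omega)
      have := hM.snd_eq m2 (hML j (by omega) h1).2
      have := (hML j (by omega) h1).1
      have : j = i + d := by omega
      exact this ▸ hsc

/-- Only the sum of the coordinates is bounded. This leaves room for at least one of them to advance
within the stretch; `hstep` then gives the next enclosing node, and `lt_iff` puts its other
coordinate into the stretch as well. -/
theorem spineCut_iterate (h : IsStretch L R i₀ i₁ r₀ r₁) {d e : ℕ}
    (hstep : ∀ i r, SpineCut L R i r → i₀ ≤ i → i < i₁ → r₀ ≤ r → r < r₁ →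
      (i + d < i₁ ∨ r + e < r₁) → SpineCut L R (i + d) (r + e)) (n : ℕ)
    (hn : i₀ + r₀ + n * (d + e) < i₁ + r₁) :
    SpineCut L R (i₀ + n * d) (r₀ + n * e) ∧ i₀ + n * d < i₁ ∧ r₀ + n * e < r₁ := by
  induction n with
  | zero => simpa using ⟨h.start, h.lt_left, h.lt_right⟩
  | succ n ih =>
    have e1 : (n + 1) * (d + e) = n * d + n * e + d + e := by ring
    have e2 : n * (d + e) = n * d + n * e := by ring
    have e3 : i₀ + (n + 1) * d = i₀ + n * d + d := by ring
    have e4 : r₀ + (n + 1) * e = r₀ + n * e + e := by ring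
    obtain ⟨h1, h2, h3⟩ := ih (by omega)
    have h4 := hstep _ _ h1 (by omega) h2 (by omega) h3 (by omega)
    have h5 := h.lt_iff h4
    rw [e3, e4]
    exact ⟨h4, by omega, by omega⟩

/-- The `6k + 2` shifts yield `6k + 3` enclosing nodes. The first interval goes to `C`, which must
be nonempty even if `i₀ = r₀ = 0`; the other `6k + 1` intervals are the copies of `Q`, and `D` is
what remains up to the hole. -/
theorem not_avoids {P : Context α} {k d e : ℕ} (h : IsStretch P.left P.right i₀ i₁ r₀ r₁)
    (hd : 0 < d) (he : 0 < e) (hde : d + e ≤ 8 * k)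
    (hlen : i₀ + r₀ + (6 * k + 2) * (8 * k) < i₁ + r₁)
    (hstep : ∀ i r, SpineCut P.left P.right i r → i₀ ≤ i → i < i₁ → r₀ ≤ r → r < r₁ →
      (i + d < i₁ ∨ r + e < r₁) → SpineCut P.left P.right (i + d) (r + e))
    (hleft : ∀ i, i₀ ≤ i → i + d < i₁ → P.left[i]? = P.left[i + d]?)
    (hright : ∀ r, r₀ ≤ r → r + e < r₁ →
      P.right[P.right.length - 1 - r]? = P.right[P.right.length - 1 - (r + e)]?) :
    ¬ P.AvoidsVerticalPeriodicity k := by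
  have hcut : ∀ n ≤ 6 * k + 2, SpineCut P.left P.right (i₀ + n * d) (r₀ + n * e) ∧
      i₀ + n * d < i₁ ∧ r₀ + n * e < r₁ := by
    intro n hn
    refine h.spineCut_iterate hstep n (lt_of_le_of_lt ?_ hlen)
    gcongr
  obtain ⟨hl, hl1, hl2⟩ := hcut (6 * k + 2) le_rfl
  have e1 : ∀ n, i₀ + d + n * d = i₀ + (n + 1) * d := fun n => by ring
  have e2 : ∀ n, r₀ + e + n * e = r₀ + (n + 1) * e := fun n => by ring
  obtain ⟨C, Q, D, h1, h2⟩ := P.exists_eq_comp_powSucc (i := i₀ + d) (r := r₀ + e) (d := d) (e := e)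
    (n := 6 * k) hd he (by omega) (by omega) (by rw [e1]; exact hl.1) (by rw [e2]; exact hl.2.1)
    (fun s hs => by rw [e1, e2]; exact (hcut (s + 1) (by omega)).1.2.2)
    (fun x hx hx' => hleft x (by omega) (by
      rw [e1] at hx'
      exact hx'.trans hl1))
    (fun x hx hx' => hright x (by omega) (by
      rw [e2] at hx'
      exact hx'.trans hl2))
  exact fun hav => hav ⟨C, Q, D, by omega, by omega, h2⟩

end IsStretch

end Matching

/-! ### Cheap alignments make few edits -/

section Edits

variable {α : Type*} {w : Weight α} {F G : List (Paren α)} {q : ℕ → ℕ × ℕ} {T : ℕ}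

/-- The step at time `t` costs at least `1`; otherwise it aligns equal labels. -/
def IsEdit (w : Weight α) (F G : List (Paren α)) (q : ℕ → ℕ × ℕ) (t : ℕ) : Prop :=
  1 ≤ stepCost (parenWeight w) F G (q t) (q (t + 1))

open Classical in
-- The cost is half of the total weight, so `2k + 1` edits would already cost `k + 1/2`.
theorem card_edits_le {k : ℕ}
    (h : tedCost w F G ((List.range (T + 1)).map q) < k + 2⁻¹) :
    ((Finset.range T).filter (IsEdit w F G q)).card ≤ 2 * k := by
  rw [tedCost, edCost_path] at h
  set E := (Finset.range T).filter (IsEdit w F G q)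
  have h1 : (E.card : ℝ≥0∞) ≤
      ∑ t ∈ Finset.range T, stepCost (parenWeight w) F G (q t) (q (t + 1)) := by
    calc (E.card : ℝ≥0∞) = ∑ t ∈ E, 1 := by simp
      _ ≤ ∑ t ∈ E, stepCost (parenWeight w) F G (q t) (q (t + 1)) :=
          Finset.sum_le_sum fun t ht => (Finset.mem_filter.1 ht).2
      _ ≤ _ := Finset.sum_le_sum_of_subset (Finset.filter_subset _ _)
  have h2 : (E.card : ℝ≥0∞) / 2 < k + 2⁻¹ := lt_of_le_of_lt (ENNReal.div_le_div_right h1 2) h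
  by_contra hcon
  push Not at hcon
  have h3 : ((2 * k + 1 : ℕ) : ℝ≥0∞) / 2 ≤ (E.card : ℝ≥0∞) / 2 :=
    ENNReal.div_le_div_right (by exact_mod_cast hcon) 2
  have h4 : ((2 * k + 1 : ℕ) : ℝ≥0∞) / 2 = k + 2⁻¹ := by
    push_cast
    rw [ENNReal.add_div, mul_comm, ENNReal.mul_div_cancel_right (by simp) (by simp), one_div]
  rw [h4] at h3
  exact absurd h2 (not_lt.2 h3)

/-- By normalization, a step between different symbols weighs at least `1`. The positions must be in
range for deletions and insertions, since an index out of range reads as `none`, that is, as `ε`. -/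
theorem IsPath.step_of_not_edit (hw : IsNormalizedQuasimetric w)
    (h : IsPath q T F.length G.length) {t : ℕ} (ht : t < T) (hE : ¬ IsEdit w F G q t) :
    q (t + 1) = ((q t).1 + 1, (q t).2 + 1) ∧
      F[(q t).1]?.map Paren.label = G[(q t).2]?.map Paren.label := by
  have hb := h.le_of_le (show t + 1 ≤ T from ht) le_rfl
  rw [h.last] at hb
  rcases h.step t ht with h1 | h1 | h1
  · refine ⟨h1, ?_⟩
    by_contra hne
    apply hE
    unfold IsEdit stepCost
    rw [h1, if_pos rfl, if_pos rfl]
    exact hw.normalized _ _ hne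
  · exfalso
    apply hE
    unfold IsEdit stepCost
    rw [h1] at hb ⊢
    simp only at hb
    rw [if_pos rfl, if_neg (by simp)]
    refine hw.normalized _ _ ?_
    rw [List.getElem?_eq_getElem (by omega)]
    simp
  · exfalso
    apply hE
    unfold IsEdit stepCost
    rw [h1] at hb ⊢
    simp only at hb
    rw [if_neg (by simp), if_pos rfl]
    refine hw.normalized _ _ ?_
    rw [List.getElem?_eq_getElem (by omega)]
    simp

theorem IsPath.exists_diagonal (hw : IsNormalizedQuasimetric w)
    (h : IsPath q T F.length G.length) {m n : ℕ} (hmn : m < n) (hn : n ≤ F.length)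
    (hE : ∀ t < T, m ≤ (q t).1 → (q t).1 < n → ¬ IsEdit w F G q t) :
    ∃ t < T, ∃ y, q t = (m, y) ∧ ∀ s < n - m, PathAligns q T (m + s) (y + s) ∧
      F[m + s]?.map Paren.label = G[y + s]?.map Paren.label := by
  obtain ⟨t, ht, h1, -⟩ := h.exists_step_fst (show m < F.length by omega)
  refine ⟨t, ht, (q t).2, by rw [← h1], ?_⟩
  have key : ∀ s ≤ n - m, t + s ≤ T ∧ q (t + s) = (m + s, (q t).2 + s) := by
    intro s
    induction s with
    | zero => intro _; exact ⟨ht.le, by rw [← h1]; rfl⟩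
    | succ s ih =>
      intro hs
      obtain ⟨h2, h3⟩ := ih (by omega)
      have h4 : t + s < T := by
        refine lt_of_le_of_ne h2 fun h4 => ?_
        have := h.last
        rw [← h4, h3] at this
        simp only [Prod.mk.injEq] at this
        omega
      have h5 := (h.step_of_not_edit hw h4 (hE _ h4 (by rw [h3]; simp) (by
        rw [h3]; simp only; omega))).1
      refine ⟨h4, ?_⟩
      rw [← add_assoc, h5, h3]
      simp only [add_assoc]
  intro s hs
  obtain ⟨h2, h3⟩ := key s hs.le
  obtain ⟨h4, h5⟩ := key (s + 1) hs
  have h6 := (h.step_of_not_edit hw (t := t + s) (by omega) (hE _ (by omega) (by rw [h3]; simp)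
    (by rw [h3]; simp only; omega))).2
  rw [h3] at h6
  exact ⟨⟨t + s, by omega, h3, h5⟩, h6⟩

open Classical in
-- Only deletions and insertions change the distance to the main diagonal; they are edits and change
-- it by one.
theorem IsPath.abs_sub_le (hw : IsNormalizedQuasimetric w)
    (h : IsPath q T F.length G.length) {t : ℕ} (ht : t ≤ T) :
    |((q t).1 : ℤ) - (q t).2| ≤ ((Finset.range T).filter (IsEdit w F G q)).card := by
  have key : ∀ t ≤ T, |((q t).1 : ℤ) - (q t).2| ≤
      ((Finset.range t).filter (IsEdit w F G q)).card := by
    intro t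
    induction t with
    | zero => intro _; simp [h.zero]
    | succ t ih =>
      intro ht
      have h1 := ih (by omega)
      rw [Finset.range_add_one, Finset.filter_insert]
      by_cases hE : IsEdit w F G q t
      · rw [if_pos hE, Finset.card_insert_of_notMem (by simp)]
        rw [abs_le] at *
        rcases h.step t (by omega) with h2 | h2 | h2 <;> rw [h2] <;> push_cast <;> omega
      · rw [if_neg hE, (h.step_of_not_edit hw (by omega) hE).1]
        push_cast
        simpa using h1
  refine (key t ht).trans ?_
  exact_mod_cast Finset.card_le_card (Finset.filter_subset_filter _
    (Finset.range_subset_range.2 ht))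

end Edits

/-! ### Non-periodicity locks the alignment to the context -/

section Crossing

variable {α : Type*}

theorem fragment_infix {β : Type*} (X : List β) (i j : ℕ) : fragment X i j <:+: X :=
  (List.drop_suffix _ _).isInfix.trans (List.take_prefix _ _).isInfix

/-- Between consecutive enclosing nodes, each half contains one parenthesis and one forest. -/
theorem SpineChain.gap_le {P : Context α} {l : ℕ} (hb : P.HalvesBalancedAtMost l) {m : ℕ}
    {o r : ℕ → ℕ} (h : SpineChain P.left P.right m o r) {i : ℕ} (hi : i < m) :
    o (i + 1) + r (i + 1) ≤ o i + r i + (2 * l + 2) := by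
  have h1 := hb _ (h.forest_left i hi) (Or.inl (fragment_infix _ _ _))
  have h2 := hb _ (h.forest_right i hi) (Or.inr (fragment_infix _ _ _))
  rw [length_fragment] at h1 h2
  have h3 := h.mono (show i + 1 ≤ m from hi) le_rfl
  rw [h.o_last, h.r_last] at h3
  have := h.o_lt i hi
  have := h.r_lt i hi
  omega

theorem SpineChain.isStretch {L R : List (Paren α)} {m : ℕ} {o r : ℕ → ℕ}
    (h : SpineChain L R m o r) {a b : ℕ} (hab : a < b) (hb : b ≤ m) :
    IsStretch L R (o a) (o b) (r a) (r b) := by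
  have hcut : ∀ l < m, SpineCut L R (o l) (r l) := by
    intro l hl
    have h3 := h.mono (show l + 1 ≤ m from hl) le_rfl
    rw [h.o_last, h.r_last] at h3
    have := h.o_lt l hl
    have := h.r_lt l hl
    exact ⟨by omega, by omega, h.tree l hl⟩
  have h1 := h.o_lt a (by omega)
  have h2 := h.r_lt a (by omega)
  have h3 := h.mono (show a + 1 ≤ b from hab) hb
  refine ⟨by omega, by omega, hcut a (by omega), ?_⟩
  rcases Nat.eq_or_lt_of_le hb with rfl | hb
  · exact Or.inl ⟨h.o_last, h.r_last⟩
  · exact Or.inr (hcut b hb)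

/-- An alignment with few edits leaves a long stretch of a long context untouched. -/
theorem SpineChain.exists_stretch {P : Context α} {k : ℕ} (hk : 0 < k)
    (hsize : 578 * k ^ 4 ≤ P.size) (hb : P.HalvesBalancedAtMost (74 * k ^ 3)) (x h : ℕ)
    (q : ℕ → ℕ × ℕ) (E : Finset ℕ) (hE : E.card ≤ 2 * k) :
    ∃ i₀ i₁ r₀ r₁, IsStretch P.left P.right i₀ i₁ r₀ r₁ ∧
      i₀ + r₀ + 64 * k ^ 3 < i₁ + r₁ ∧
      ∀ t ∈ E, ¬ (x + i₀ ≤ (q t).1 ∧ (q t).1 < x + i₁) ∧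
        ¬ (x + P.left.length + h + P.right.length - r₁ ≤ (q t).1 ∧
          (q t).1 < x + P.left.length + h + P.right.length - r₀) := by
  classical
  obtain ⟨m, o, r, hc⟩ := exists_spineChain P.left_ne_nil P.right_ne_nil P.isTree
  set e := x + P.left.length + h + P.right.length with he
  by_contra hcon
  push Not at hcon
  have hle : ∀ l ≤ m, o l ≤ P.left.length ∧ r l ≤ P.right.length := by
    intro l hl
    have := hc.mono hl le_rfl
    rwa [hc.o_last, hc.r_last] at this
  -- The edit at time `t` falls between the enclosing nodes `l` and `l + 1`, in either half. These
  -- regions are disjoint for different `l`, so an edit spoils at most one step of the chain.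
  let hit : ℕ → ℕ → Prop := fun l t =>
    (x + o l ≤ (q t).1 ∧ (q t).1 < x + o (l + 1)) ∨ (e - r (l + 1) ≤ (q t).1 ∧ (q t).1 < e - r l)
  have hhit : ∀ l l' t, l < m → l' < m → hit l t → hit l' t → l = l' := by
    intro l l' t hl hl' h1 h2
    by_contra hne
    have hx := hle (l + 1) hl
    have hx' := hle (l' + 1) hl'
    rcases Nat.lt_or_gt_of_ne hne with h3 | h3
    · have := hc.mono (show l + 1 ≤ l' from h3) hl'.le
      simp only [hit] at h1 h2
      omega
    · have := hc.mono (show l' + 1 ≤ l from h3) hl.le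
      simp only [hit] at h1 h2
      omega
  let Bad := (Finset.range m).filter fun l => ∃ t ∈ E, hit l t
  have hBad : Bad.card ≤ 2 * k := by
    refine le_trans ?_ hE
    have hch : ∀ l ∈ Bad, ∃ t ∈ E, hit l t := fun l hl => (Finset.mem_filter.1 hl).2
    choose! f hf hf' using hch
    refine Finset.card_le_card_of_injOn f hf ?_
    intro l hl l' hl' hll
    have h1 := Finset.mem_range.1 (Finset.mem_filter.1 hl).1
    have h1' := Finset.mem_range.1 (Finset.mem_filter.1 hl').1
    exact hhit l l' (f l) h1 h1' (hf' l hl) (hll ▸ hf' l' hl')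
  have key := le_of_good_stretches (t := fun l => o l + r l) (Z := 2 * (74 * k ^ 3) + 2)
    (W := 64 * k ^ 3) (2 * k) Bad m (fun l hl => hc.gap_le hb hl) (by
      intro a b hab hbm hgood
      by_contra hlong
      push Not at hlong
      obtain ⟨t, ht, hbad⟩ := hcon _ _ _ _ (hc.isStretch hab hbm) hlong
      have hex : ∃ l, a ≤ l ∧ l < b ∧ hit l t := by
        -- A discrete intermediate value argument: a position in the stretch falls between two
        -- consecutive nodes.
        have hfind : ∀ (g : ℕ → ℕ) (z : ℕ), g a ≤ z → z < g b →
            ∃ l, a ≤ l ∧ l < b ∧ g l ≤ z ∧ z < g (l + 1) := by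
          intro g z h1 h2
          by_contra hno
          push Not at hno
          have : ∀ l, a ≤ l → l ≤ b → g l ≤ z := by
            intro l hl
            induction l, hl using Nat.le_induction with
            | base => intro _; exact h1
            | succ l hl ih => intro hlb; exact hno l hl hlb (ih (by omega))
          exact absurd (this b hab.le le_rfl) (by omega)
        by_cases h1 : x + o a ≤ (q t).1 ∧ (q t).1 < x + o b
        · obtain ⟨l, hl, hl', h2⟩ := hfind (fun l => x + o l) _ h1.1 h1.2
          exact ⟨l, hl, hl', Or.inl h2⟩
        · have h2 := hbad (fun h3 => by by_contra h4; exact h1 ⟨h3, by omega⟩)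
          have hb' := hle b hbm
          have ha' := hle a (by omega)
          obtain ⟨l, hl, hl', h3⟩ := hfind r (e - 1 - (q t).1) (by omega) (by omega)
          have hx := hle (l + 1) (by omega)
          exact ⟨l, hl, hl', Or.inr (by omega)⟩
      obtain ⟨l, hl, hl', h1⟩ := hex
      exact hgood l hl hl' (Finset.mem_filter.2 ⟨Finset.mem_range.2 (by omega), t, ht, h1⟩))
    ((Finset.card_filter_le _ _).trans hBad)
  simp only [hc.o_last, hc.r_last, hc.o_zero, hc.r_zero] at key
  have hs : P.left.length + P.right.length = P.size := rfl
  rw [hs] at key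
  have h3 : k ≤ k ^ 4 := Nat.le_self_pow (by norm_num) k
  have h4 : k ^ 3 ≤ k ^ 4 := Nat.pow_le_pow_right hk (by norm_num)
  -- If all clean stretches were short, the size would be at most `424k⁴ + 4k + 64k³ ≤ 492k⁴`, which
  -- is less than `578k⁴`.
  have h5 : 0 + 0 + 2 * k * (2 * (74 * k ^ 3) + 2) + (2 * k + 1) * (64 * k ^ 3) =
      424 * k ^ 4 + 4 * k + 64 * k ^ 3 := by ring
  have h6 : 0 < k ^ 4 := by positivity
  omega

/-- A cheap alignment of two forests that contain a long non-periodic context at almost the same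
place passes through diagonal points in both halves of the context. -/
theorem exists_diagonal_points {w : Weight α} (hw : IsNormalizedQuasimetric w) {k : ℕ}
    (hk : 0 < k) {P : Context α} (hsize : 578 * k ^ 4 ≤ P.size)
    (hv : P.AvoidsVerticalPeriodicity k) (hb : P.HalvesBalancedAtMost (74 * k ^ 3))
    {X H Y X' H' Y' : List (Paren α)} (hH : IsForest H) (hH' : IsForest H')
    (hF : IsForest (plug X P.left H P.right Y)) {A : List (ℕ × ℕ)}
    (hA : IsForestAlignment A (plug X P.left H P.right Y) (plug X' P.left H' P.right Y'))
    (hcost : tedCost w (plug X P.left H P.right Y) (plug X' P.left H' P.right Y') A < k + 2⁻¹)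
    (ho : |(X.length : ℤ) - X'.length| ≤ 2 * k)
    (hc : |((X.length + H.length : ℕ) : ℤ) - (X'.length + H'.length : ℕ)| ≤ 2 * k) :
    (∃ s ≤ P.left.length, ∀ i j, Aligns A i j → (i < X.length + s ↔ j < X'.length + s)) ∧
    ∃ s ≤ P.right.length, ∀ i j, Aligns A i j →
      (i < X.length + P.left.length + H.length + s ↔
        j < X'.length + P.left.length + H'.length + s) := by
  classical
  have hM := hA.isNodeMatching hF
  have hT : IsForest (P.left ++ (H ++ P.right)) := (P.isTree_fill hH).isForest
  have hT' : IsForest (P.left ++ (H' ++ P.right)) := (P.isTree_fill hH').isForest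
  obtain ⟨q, T, hq, rfl⟩ := isAlignment_iff_exists_path.1 hA.isAlignment
  have hE := card_edits_le hcost
  have hshift : ∀ t ≤ T, |((q t).1 : ℤ) - (q t).2| ≤ 2 * k := fun t ht =>
    (hq.abs_sub_le hw ht).trans (by exact_mod_cast hE)
  obtain ⟨i₀, i₁, r₀, r₁, hS, hlong, hclean⟩ := SpineChain.exists_stretch hk hsize hb X.length
    H.length q _ hE
  obtain ⟨hl1, hl2⟩ := hS.le_length
  have hlt1 := hS.lt_left
  have hlt2 := hS.lt_right
  obtain ⟨t₁, ht₁, y₁, hy₁, hd₁⟩ := hq.exists_diagonal hw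
    (show X.length + i₀ < X.length + i₁ by omega) (by rw [length_plug]; omega)
    (fun t ht h1 h2 h3 => (hclean t (Finset.mem_filter.2 ⟨Finset.mem_range.2 ht, h3⟩)).1 ⟨h1, h2⟩)
  obtain ⟨t₂, ht₂, y₂, hy₂, hd₂⟩ := hq.exists_diagonal hw
    (show X.length + P.left.length + H.length + P.right.length - r₁ <
      X.length + P.left.length + H.length + P.right.length - r₀ by omega)
    (by rw [length_plug]; omega)
    (fun t ht h1 h2 h3 => (hclean t (Finset.mem_filter.2 ⟨Finset.mem_range.2 ht, h3⟩)).2 ⟨h1, h2⟩)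
  have hs₁ := hshift t₁ ht₁.le
  have hs₂ := hshift t₂ ht₂.le
  rw [hy₁] at hs₁
  rw [hy₂] at hs₂
  simp only at hs₁ hs₂
  set M := Aligns ((List.range (T + 1)).map q) with hMdef
  have hL : ∀ i, i₀ ≤ i → i < i₁ → M (X.length + i) (y₁ + (i - i₀)) ∧
      (plug X P.left H P.right Y)[X.length + i]? =
        (plug X' P.left H' P.right Y')[y₁ + (i - i₀)]? := by
    intro i hi hi'
    obtain ⟨h1, h2⟩ := hd₁ (i - i₀) (by omega)
    rw [show X.length + i₀ + (i - i₀) = X.length + i by omega] at h1 h2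
    have h3 : M (X.length + i) (y₁ + (i - i₀)) := pair_infix_path_iff.2 h1
    exact ⟨h3, hM.letter_eq h3 h2⟩
  have hR : ∀ r, r₀ ≤ r → r < r₁ →
      M (X.length + P.left.length + H.length + P.right.length - 1 - r) (y₂ + (r₁ - 1 - r)) ∧
      (plug X P.left H P.right Y)[X.length + P.left.length + H.length + P.right.length - 1 - r]? =
        (plug X' P.left H' P.right Y')[y₂ + (r₁ - 1 - r)]? := by
    intro r hr hr'
    obtain ⟨h1, h2⟩ := hd₂ (r₁ - 1 - r) (by omega)
    rw [show X.length + P.left.length + H.length + P.right.length - r₁ + (r₁ - 1 - r) =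
      X.length + P.left.length + H.length + P.right.length - 1 - r by omega] at h1 h2
    have h3 : M (X.length + P.left.length + H.length + P.right.length - 1 - r)
      (y₂ + (r₁ - 1 - r)) := pair_infix_path_iff.2 h1
    exact ⟨h3, hM.letter_eq h3 h2⟩
  have hletL : ∀ (X H Y : List (Paren α)) i, i < P.left.length →
      (plug X P.left H P.right Y)[X.length + i]? = P.left[i]? :=
    fun X H Y i hi => getElem?_plug_left _ _ _ _ _ hi
  have hletR : ∀ (X H Y : List (Paren α)) r, r < P.right.length →
      (plug X P.left H P.right Y)[X.length + P.left.length + H.length + P.right.length - 1 - r]? =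
        P.right[P.right.length - 1 - r]? := by
    intro X H Y r hr
    rw [show X.length + P.left.length + H.length + P.right.length - 1 - r =
      X.length + P.left.length + H.length + (P.right.length - 1 - r) by omega]
    exact getElem?_plug_right _ _ _ _ _ (by omega)
  have hu := (mem_nodes_plug_iff_spineCut (X := X) (Y := Y) hH hS.start.1 hS.start.2.1).2 hS.start
  have hu' := (mem_nodes_plug_iff_spineCut (X := X') (Y := Y') hH' hS.start.1 hS.start.2.1).2
    hS.start
  have hm₁ := (hL i₀ le_rfl hlt1).1
  have hm₂ := (hR r₀ le_rfl hlt2).1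
  -- The image of the outermost node of the stretch, to be compared with the copy `hu'` of this node
  -- in the second occurrence.
  obtain ⟨c, hvn, hm₃⟩ := hM.opening_node _ _ _ hm₁ hu
  rw [← hM.snd_eq hm₂ hm₃] at hvn
  rw [Nat.sub_self, add_zero] at hvn
  have hk3 : k ≤ k ^ 3 := Nat.le_self_pow (by norm_num) k
  have hk23 : k ^ 2 ≤ k ^ 3 := Nat.pow_le_pow_right hk (by norm_num)
  have hper : i₀ + r₀ + (6 * k + 2) * (8 * k) < i₁ + r₁ := by
    have : (6 * k + 2) * (8 * k) = 48 * k ^ 2 + 16 * k := by ring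
    omega
  rw [abs_le] at hs₁ hs₂ ho hc
  push_cast [Nat.cast_sub (show r₁ ≤ X.length + P.left.length + H.length + P.right.length by omega)]
    at hs₁ hs₂ ho hc
  -- The offset of the openings decides: nodes nest, so an image opening further out also closes
  -- further out, one opening further in also closes further in, and equal openings have equal
  -- closings.
  rcases lt_trichotomy y₁ (X'.length + i₀) with hlt | heq | hgt
  · exfalso
    have hn := nodes_nest_lt hvn hu' hlt (by omega)
    obtain ⟨d, hd⟩ := Nat.exists_eq_add_of_lt hlt
    obtain ⟨e, he⟩ := Nat.exists_eq_add_of_lt hn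
    -- Both offsets are positive and at most `4k`: `2k` from the drift of the alignment and `2k`
    -- from the distance between the occurrences.
    refine hS.not_avoids (d := d + 1) (e := e + 1) (k := k) (by omega) (by omega) (by omega) hper
      (fun i r hs hi hi' hr hr' hrem => hS.spineCut_outward hM hH hH' hT (by omega) (by omega)
        ?_ ?_ hs hi hi' hr hr' hrem) ?_ ?_ hv
    · intro i hi hi'
      refine ⟨by omega, ?_⟩
      have := (hL i hi hi').1
      rwa [show X'.length + i - (d + 1) = y₁ + (i - i₀) by omega]
    · intro r hr hr'
      have := (hR r hr hr').1
      rwa [show X'.length + P.left.length + H'.length + P.right.length - 1 - r + (e + 1) =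
        y₂ + (r₁ - 1 - r) by omega]
    -- Position `i + (d + 1)` is matched with the copy of position `i` and carries the same letter,
    -- so the offset is a period of the left half.
    · intro i hi hi'
      have := (hL (i + (d + 1)) (by omega) hi').2
      rw [show y₁ + (i + (d + 1) - i₀) = X'.length + i by omega, hletL _ _ _ _ (by omega),
        hletL _ _ _ _ (by omega)] at this
      exact this.symm
    · intro r hr hr'
      have := (hR (r + (e + 1)) (by omega) hr').2
      rw [show y₂ + (r₁ - 1 - (r + (e + 1))) =
        X'.length + P.left.length + H'.length + P.right.length - 1 - r by omega,
        hletR _ _ _ _ (by omega), hletR _ _ _ _ (by omega)] at this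
      exact this.symm
  · subst heq
    have hcl := nodes_closing_unique hvn hu'
    rw [hcl] at hm₂
    rw [Nat.sub_self, add_zero] at hm₁
    -- A matched pair is itself a point of the alignment. Since `r₀` is counted from the right end,
    -- the point in the right half is at `P.right.length - 1 - r₀`.
    refine ⟨⟨i₀, by omega, fun i j hij => hM.lt_iff _ _ _ _ hij hm₁⟩,
      ⟨P.right.length - 1 - r₀, by omega, fun i j hij => ?_⟩⟩
    have := hM.lt_iff _ _ _ _ hij hm₂
    omega
  · exfalso
    have hn := nodes_nest_lt hu' hvn hgt (by omega)
    obtain ⟨d, hd⟩ := Nat.exists_eq_add_of_lt hgt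
    obtain ⟨e, he⟩ := Nat.exists_eq_add_of_lt hn
    refine hS.not_avoids (d := d + 1) (e := e + 1) (k := k) (by omega) (by omega) (by omega) hper
      (fun i r hs hi hi' hr hr' hrem => hS.spineCut_inward hM hH hH' hT' (by omega) (by omega)
        ?_ ?_ hs hi hi' hr hr' hrem) ?_ ?_ hv
    · intro i hi hi'
      have := (hL i hi hi').1
      rwa [show X'.length + i + (d + 1) = y₁ + (i - i₀) by omega]
    · intro r hr hr'
      refine ⟨by omega, ?_⟩
      have := (hR r hr hr').1
      rwa [show X'.length + P.left.length + H'.length + P.right.length - 1 - r - (e + 1) =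
        y₂ + (r₁ - 1 - r) by omega]
    · intro i hi hi'
      have := (hL i hi (by omega)).2
      rw [show y₁ + (i - i₀) = X'.length + (i + (d + 1)) by omega, hletL _ _ _ _ (by omega),
        hletL _ _ _ _ (by omega)] at this
      exact this
    · intro r hr hr'
      have := (hR r hr (by omega)).2
      rw [show y₂ + (r₁ - 1 - r) =
        X'.length + P.left.length + H'.length + P.right.length - 1 - (r + (e + 1)) by omega,
        hletR _ _ _ _ (by omega), hletR _ _ _ _ (by omega)] at this
      exact this

end Crossing

/-! ### Equivalence of the two contexts -/

section Equivalence

variable {α : Type*}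

theorem Context.OccursAt.exists_plug {C : Context α} {F : List (Paren α)} {u : ℕ × ℕ}
    (h : C.OccursAt F u) : ∃ X H Y, IsForest H ∧ F = plug X C.left H C.right Y ∧
      u.1 = X.length ∧
      u.2 + 1 = X.length + C.left.length + H.length + C.right.length ∧
      ∀ C' : Context α, C.replace C' F u = plug X C'.left H C'.right Y := by
  obtain ⟨⟨h1, h2, -⟩, H, hH, h3⟩ := h
  have hsplit : F = F.take u.1 ++ (fragment F u.1 (u.2 + 1) ++ F.drop (u.2 + 1)) := by
    rw [← fragment_zero, ← fragment_length, fragment_append_fragment _ (by omega) h2 le_rfl,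
      fragment_append_fragment _ (by omega) (by omega) le_rfl, fragment_zero_length]
  have hlen := congrArg List.length h3
  rw [length_fragment] at hlen
  simp only [List.length_append] at hlen
  have hX : (F.take u.1).length = u.1 := by rw [List.length_take]; omega
  have hF : F = plug (F.take u.1) C.left H C.right (F.drop (u.2 + 1)) := by
    rw [h3] at hsplit
    simpa [plug] using hsplit
  refine ⟨F.take u.1, H, F.drop (u.2 + 1), hH, hF, hX.symm, by omega, ?_⟩
  intro C'
  have hfrag : fragment F (u.1 + C.left.length) (u.2 + 1 - C.right.length) = H := by
    have := fragment_of_append (F.take u.1 ++ C.left) H (C.right ++ F.drop (u.2 + 1)) (o := 0)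
      (c := H.length) le_rfl
    rw [fragment_zero_length, List.length_append, hX] at this
    rw [← this, add_zero, show u.2 + 1 - C.right.length = u.1 + C.left.length + H.length by omega]
    conv_lhs => rw [hF]
    simp [plug]
  rw [Context.replace, hfrag]
  simp [plug]

theorem isForest_plug_iff {C C' : Context α} {X H Y : List (Paren α)} (hH : IsForest H) :
    IsForest (plug X C.left H C.right Y) ↔ IsForest (plug X C'.left H C'.right Y) := by
  have e : ∀ C : Context α, plug X C.left H C.right Y = X ++ ((C.left ++ (H ++ C.right)) ++ Y) :=
    fun C => by simp [plug]
  rw [e, e, isForest_insert_iff (C.isTree_fill hH).isForest,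
    isForest_insert_iff (C'.isTree_fill hH).isForest]

/-- If the claim failed, some alignment would cost less than both the new distance and `k + 1/2`,
and replacing the context in it would contradict the former bound. The slack `1/2` makes it
unnecessary that the infimum be attained. -/
theorem ted_replace_le {w : Weight α} (hw : IsNormalizedQuasimetric w) {k : ℕ}
    (hk : 0 < k) {P : Context α} (P' : Context α) (hsize : 578 * k ^ 4 ≤ P.size)
    (hv : P.AvoidsVerticalPeriodicity k) (hb : P.HalvesBalancedAtMost (74 * k ^ 3))
    {X H Y X' H' Y' : List (Paren α)} (hH : IsForest H) (hH' : IsForest H')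
    (hF : IsForest (plug X P.left H P.right Y))
    (ho : |(X.length : ℤ) - X'.length| ≤ 2 * k)
    (hc : |((X.length + H.length : ℕ) : ℤ) - (X'.length + H'.length : ℕ)| ≤ 2 * k)
    (hted : ted w (plug X P.left H P.right Y) (plug X' P.left H' P.right Y') ≤ k) :
    ted w (plug X P'.left H P'.right Y) (plug X' P'.left H' P'.right Y') ≤
      ted w (plug X P.left H P.right Y) (plug X' P.left H' P.right Y') := by
  by_contra hcon
  rw [not_le] at hcon
  have hlt : ted w (plug X P.left H P.right Y) (plug X' P.left H' P.right Y') <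
      min (ted w (plug X P'.left H P'.right Y) (plug X' P'.left H' P'.right Y')) (k + 2⁻¹) := by
    refine lt_min hcon (lt_of_le_of_lt hted ?_)
    exact ENNReal.lt_add_right (by simp) (by simp)
  obtain ⟨A, hA⟩ := iInf_lt_iff.1 hlt
  obtain ⟨hA, hcost⟩ := iInf_lt_iff.1 hA
  obtain ⟨hcost1, hcost2⟩ := lt_min_iff.1 hcost
  obtain ⟨hc1, hc2⟩ := exists_diagonal_points hw hk hsize hv hb hH hH' hF hA hcost2 ho hc
  obtain ⟨A', hA', hle⟩ := exists_isForestAlignment_replace hw hH hH'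
    (P.isTree_fill hH).isForest (P.isTree_fill hH').isForest (P'.isTree_fill hH).isForest
    (P'.isTree_fill hH').isForest hA hc1 hc2
  exact absurd (hle.trans_lt hcost1) (not_lt.2 (iInf₂_le A' hA'))

end Equivalence

end TreeEdit

theorem mainTheorem10 {α : Type*} (k : ℕ) (hk : 0 < k) (P P' : TreeEdit.Context α)
    (hP : 578 * k ^ 4 ≤ P.size) (hP' : 578 * k ^ 4 ≤ P'.size)
    (hPv : P.AvoidsVerticalPeriodicity k) (hPv' : P'.AvoidsVerticalPeriodicity k)
    (hPb : P.HalvesBalancedAtMost (74 * k ^ 3)) (hPb' : P'.HalvesBalancedAtMost (74 * k ^ 3))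
    (w : TreeEdit.Weight α) (hw : TreeEdit.IsNormalizedQuasimetric w) :
    TreeEdit.TedEquivalent w k P P' := by
  open TreeEdit in
  intro F G hF hG u v hu hv ho hc
  obtain ⟨X, H, Y, hH, rfl, hX, hXe, hrep⟩ := hu.exists_plug
  obtain ⟨X', H', Y', hH', rfl, hX', hXe', hrep'⟩ := hv.exists_plug
  rw [hrep, hrep']
  have ho' : |(X.length : ℤ) - X'.length| ≤ 2 * k := by rwa [← hX, ← hX']
  -- Both occurrences have halves of the same lengths, so these cancel in the difference of the
  -- closing positions.
  have hc' : |((X.length + H.length : ℕ) : ℤ) - (X'.length + H'.length : ℕ)| ≤ 2 * k := by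
    have : ((X.length + H.length : ℕ) : ℤ) - (X'.length + H'.length : ℕ) =
        (u.2 : ℤ) - (v.2 : ℤ) := by omega
    rwa [this]
  have hF' := (isForest_plug_iff (C := P) (C' := P') hH).1 hF
  have h1 := ted_replace_le hw hk P' hP hPv hPb (Y' := Y') hH hH' hF ho' hc'
  -- The roles of `P` and `P'` are exchanged; `ho'` and `hc'` involve only the surroundings and the
  -- holes, so they serve again.
  have h2 := ted_replace_le hw hk P hP' hPv' hPb' (Y' := Y') hH hH' hF' ho' hc'
  unfold tedLe
  have hcast : ((k : ℝ≥0) : ℝ≥0∞) = k := by simp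
  rw [hcast]
  by_cases h : ted w (plug X P.left H P.right Y) (plug X' P.left H' P.right Y') ≤ k
  · have h3 := h1 h
    rw [if_pos h, if_pos (h3.trans h)]
    exact le_antisymm (h2 (h3.trans h)) h3
  · rw [if_neg h, if_neg fun h4 => h ((h2 h4).trans h4)]
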